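/- Let $X_{t+1}=\lambda X_t+W_t$ with $|\lambda|>1$, where $(W_t)$ is iid with bounded support and $X_0$ is independent of it and uniform on $[-\Omega_0/2,\Omega_0/2]$; let $\eta>0$. The following two-stream fixed-rate source code is used. Let $T$ be uniform on $\{0,\dots,Mn-1\}$ and let the dithers $\Theta_t,\Theta'_t$ be iid uniform on $[-\Delta/2,\Delta/2]$, all independent of the source and known to the source encoder and decoder; let $Q_\Delta$ be rounding to the nearest point of $\Delta\mathbb Z$, and put $\check X_t=Q_\Delta(X_t+\Theta_t)-\Theta_t$ and $\check X'_t=Q_\Delta(X_t+\Theta'_t)-\Theta'_t$. For $t<T$ the reconstruction is $\widehat X_t=\check X_t$. From time $T$ on, time is cut into blocks of length $n$. With $\tau_k=T+kn$, block $k$ has the normalized history $\widetilde X_{k,i}=X_{\tau_k+i}-\lambda^i\check X_{\tau_k}$ $(0\le i<n)$ and the side information $Z_k=\check X'_{\tau_k+n-1}-\lambda^{n-1}\check X_{\tau_k}$. A measurable conditional encoder maps each superblock $(\widetilde X_k,Z_k)_{mM\le k<(m+1)M}$ to $K\ge1$ bits; these bits form the historical stream, of rate $R_2=K/(Mn)$.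 A measurable conditional decoder maps the $K$ bits and the $Z_k$ of the superblock to values $T_{k,i}$, and $\widehat X_{\tau_k+i}=T_{k,i}+\lambda^i\check X_{\tau_k}$. The checkpoints (the $\check X_t$ for $t<T$, the $\check X_{\tau_k}$ and the $\check X'_{\tau_k+n-1}$) are conveyed by the other stream, and the source decoder has them exactly. Let $D_t=E|X_t-\widehat X_t|^\eta$ be the distortion of this code when the historical stream is received without errors (noiseless channel), and suppose $D_t<\infty$ for all $t$. Consider a channel given by conditional laws $p(c_t\mid a_1^t,c_1^{t-1})$ and a rate $R_2$ communication system without feedback for it (for each end-to-end delay $\phi$ a causal channel encoder and a delay-$\phi$ channel decoder, possibly using common randomness independent of source and channel). Suppose that the system meets any bit-error probability given a long enough delay: for every $\epsilon>0$ there is $\phi_0$ such that for all $\phi\ge\phi_0$ every message bit $i$ satisfies $P(\widehat B_i\ne B_i)\le\epsilon$, either (i) when the message bits are independent fair coin tosses, or (ii) for every realization of the message bits. In case (ii) send the historical stream itself through the system; in case (i) send it XORed with a sequence of independent fair common random bits, which the receiver removes. Let $D_t^{\phi}$ be the resulting expected end-to-end distortion at time $t$ when the delay-$\phi$ channel encoder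 and decoder are used. Then: (a) The resulting system is causal, and with respect to the channel outputs its end-to-end delay is at most $\phi+3Mn$. (b) If, for every fixed string of $K$ bits handed to the conditional decoder and every $t$, the expected distortion $E|X_t-\widehat X_t|^\eta$ is finite (for instance if the values $T_{k,i}$ are bounded), then for every $\delta>0$ there is $\phi_0$ such that $|D^\phi_t-D_t|\le\delta$ for all $\phi\ge\phi_0$ and all $t$. (c) Without that condition, for every $\delta>0$ there is $L_0$ such that for every $L\ge L_0$ there is $\phi_0$ such that $|D^{\phi,L}_t-D_t|\le\delta$ for all $\phi\ge\phi_0$ and all $t$, where $D_t^{\phi,L}$ is the expected end-to-end distortion when the values $T_{k,i}$ produced by the conditional decoder are limited to $[-L,L]$. The delay bound in (a) holds for these systems too. -/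

import Mathlib

open MeasureTheory ProbabilityTheory
open scoped ENNReal

universe u v

namespace TwoStream

noncomputable section

/-! ### The unstable scalar Markov source -/

/-- The source `X_{t+1} = lam * X_t + W_t`: unstable gain `|lam| > 1`, iid driving noise of bounded
support with common law `noise`, and `X_0` uniform on `[-width/2, width/2]`. -/
structure Source where
  lam : ℝ
  one_lt_abs_lam : 1 < |lam|
  width : ℝ
  width_pos : 0 < width
  noise : Measure ℝ
  noise_prob : IsProbabilityMeasure noise
  noise_bounded : ∃ B : ℝ, ∀ᵐ w ∂noise, |w| ≤ B

/-- The uniform law on `[-a/2, a/2]`. -/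
def uniformLaw (a : ℝ) : Measure ℝ := ProbabilityTheory.cond volume (Set.Icc (-a / 2) (a / 2))

/-- A realization of all the randomness on the source side:
`(X_0, (W_t), (Θ_t), (Θ'_t), T)`. Here `Θ_t` and `Θ'_t` are the dithers available for quantizing
`X_t` as an opening, respectively closing, checkpoint, and `T` is the random starting offset.
The dithers and `T` are common randomness of the source encoder and the source decoder. -/
abbrev Outcome : Type := ℝ × (ℕ → ℝ) × (ℕ → ℝ) × (ℕ → ℝ) × ℕ

/-- The process `X_t`. -/
def process (lam : ℝ) (ω : Outcome) : ℕ → ℝ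
  | 0 => ω.1
  | t + 1 => lam * process lam ω t + ω.2.1 t

/-- The dither of the opening checkpoint at time `t`. -/
def dither (ω : Outcome) (t : ℕ) : ℝ := ω.2.2.1 t

/-- The dither of the closing checkpoint at time `t`. -/
def ditherEnd (ω : Outcome) (t : ℕ) : ℝ := ω.2.2.2.1 t

/-- The random offset at which the main phase of the code starts. -/
def offset (ω : Outcome) : ℕ := ω.2.2.2.2

/-! ### The two-stream fixed-rate source code -/

/-- The uniform quantizer of step `Δ`: the nearest point of `Δℤ`. -/
def quantize (Δ x : ℝ) : ℝ := Δ * (round (x / Δ) : ℤ)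

/-- The data of a two-stream source code with blocks of `n` source symbols, superblocks of `M`
blocks, checkpoint resolution `Δ`, and `K` historical bits per superblock. `enc` and `recon` are
the conditional (side-information) block encoder and decoder for a superblock: `enc` sees the
normalized history `(X̃_{k,i})` and the quantized normalized endpoints `(Z_k)`, and `recon` sees
the `K` bits and the `(Z_k)`. -/
structure Code where
  n : ℕ
  M : ℕ
  K : ℕ
  n_pos : 0 < n
  M_pos : 0 < M
  K_pos : 0 < K
  Δ : ℝ
  Δ_pos : 0 < Δ
  enc : (Fin M → Fin n → ℝ) → (Fin M → ℝ) → (Fin K → Bool)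
  enc_measurable : Measurable (Function.uncurry enc)
  recon : (Fin K → Bool) → (Fin M → ℝ) → (Fin M → Fin n → ℝ)
  recon_measurable : ∀ b, Measurable (recon b)

namespace Code

variable (code : Code)

/-- The length of a superblock in source symbols. -/
def len : ℕ := code.n * code.M

/-- The rate of the historical stream, in bits per unit of time. -/
def rate : ℝ := (code.K : ℝ) / (code.len : ℝ)

/-- The same code, with the outputs of the superblock decoder limited to `[-L, L]`. -/
def truncate (L : ℝ) : Code :=
  { code with
    recon := fun b z k i => max (-L) (min L (code.recon b z k i))
    recon_measurable := fun b => by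
      refine measurable_pi_lambda _ fun k => measurable_pi_lambda _ fun i => ?_
      have h : Measurable fun z => code.recon b z k i :=
        (measurable_pi_apply i).comp ((measurable_pi_apply k).comp (code.recon_measurable b))
      exact measurable_const.max (measurable_const.min h) }

end Code

/-- The joint law of `(X_0, W, Θ, Θ', T)`: everything is independent, the dithers are iid uniform on
`[-Δ/2, Δ/2]`, and `T` is uniform on `{0, …, nM - 1}`. -/
def sourceLaw (src : Source) (code : Code) : Measure Outcome :=
  (uniformLaw src.width).prod
    ((Measure.infinitePi fun _ : ℕ => src.noise).prod
      ((Measure.infinitePi fun _ : ℕ => uniformLaw code.Δ).prod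
        ((Measure.infinitePi fun _ : ℕ => uniformLaw code.Δ).prod
          (uniformOn (Set.Iio code.len)))))

section Coding

variable (src : Source) (code : Code) (ω : Outcome)

/-- The opening checkpoint at time `t`: subtractively dithered quantization of `X_t`. -/
def checkpoint (t : ℕ) : ℝ :=
  quantize code.Δ (process src.lam ω t + dither ω t) - dither ω t

/-- The closing checkpoint at time `t`: subtractively dithered quantization of `X_t`, with a
dither of its own. -/
def checkpointEnd (t : ℕ) : ℝ :=
  quantize code.Δ (process src.lam ω t + ditherEnd ω t) - ditherEnd ω t

/-- The time at which block `k` of the main phase opens. -/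
def blockStart (k : ℕ) : ℕ := offset ω + k * code.n

/-- The normalized history `X̃_{k,i}` of block `k`. -/
def history (k i : ℕ) : ℝ :=
  process src.lam ω (blockStart code ω k + i) -
    src.lam ^ i * checkpoint src code ω (blockStart code ω k)

/-- The side information `Z_k`: the normalized closing checkpoint of block `k`. -/
def sideInfo (k : ℕ) : ℝ :=
  checkpointEnd src code ω (blockStart code ω k + (code.n - 1)) -
    src.lam ^ (code.n - 1) * checkpoint src code ω (blockStart code ω k)

/-- The historical bits of superblock `m`, which consists of the blocks `mM, …, mM + M - 1`. -/
def historyBits (m : ℕ) : Fin code.K → Bool :=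
  code.enc (fun k i => history src code ω (m * code.M + k) i)
    (fun k => sideInfo src code ω (m * code.M + k))

/-- The position in the historical stream (counted from `0`) of bit `j` of superblock `m`.
The first two superblock lengths of the stream hold filler, so that for every value of the offset
superblock `m` is over before the first of its bits is due. -/
def position (m : ℕ) (j : Fin code.K) : ℕ := (m + 2) * code.K + j

/-- The historical message stream. -/
def historyStream (p : ℕ) : Bool :=
  if p < 2 * code.K then false
  else historyBits src code ω (p / code.K - 2) ⟨p % code.K, Nat.mod_lt _ code.K_pos⟩

/-- The superblock that contains time `t ≥ T`. -/
def superblockOf (t : ℕ) : ℕ := (t - offset ω) / code.len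

/-- The reconstruction of `X_t` when `b` are the historical bits handed to the source decoder for
the superblock of `t`. During the initial phase, `t < T`, it is the (high fidelity) checkpoint at
`t`. The checkpoints, as well as the dithers and `T`, are known at the decoder. -/
def estimate (b : Fin code.K → Bool) (t : ℕ) : ℝ :=
  if t < offset ω then checkpoint src code ω t
  else
    let s := t - offset ω
    let m := superblockOf code ω t
    let k : ℕ := s / code.n
    let i : ℕ := s % code.n
    code.recon b (fun k' => sideInfo src code ω (m * code.M + k'))
        ⟨k % code.M, Nat.mod_lt _ code.M_pos⟩ ⟨i, Nat.mod_lt _ code.n_pos⟩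
      + src.lam ^ i * checkpoint src code ω (blockStart code ω k)

end Coding

/-- The `η`-distortion `|x - y|^η`. -/
def distortion (η x y : ℝ) : ℝ≥0∞ := ENNReal.ofReal (|x - y| ^ η)

/-- The expected distortion `E|X_t - X̂_t|^η` of the code when the historical stream is received
without errors. -/
def noiselessDistortion (src : Source) (code : Code) (η : ℝ) (t : ℕ) : ℝ≥0∞ :=
  ∫⁻ ω, distortion η (process src.lam ω t)
    (estimate src code ω (historyBits src code ω (superblockOf code ω t)) t) ∂(sourceLaw src code)

/-- The expected distortion at time `t` when the source decoder is handed the fixed bit string `b`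
for the superblock of `t`. -/
def fixedBitsDistortion (src : Source) (code : Code) (η : ℝ) (b : Fin code.K → Bool) (t : ℕ) :
    ℝ≥0∞ :=
  ∫⁻ ω, distortion η (process src.lam ω t) (estimate src code ω b t) ∂(sourceLaw src code)

/-! ### Noisy channels -/

/-- A discrete time channel: the conditional law of the output `c_t` given the inputs up to and
including time `t` and the outputs before time `t`. Index `t` stands for the channel use at time
`t + 1`, i.e. channel uses happen at times `1, 2, …`. -/
structure Channel (A C : Type u) [MeasurableSpace A] [MeasurableSpace C] where
  trans : ∀ t : ℕ, Kernel ((Fin (t + 1) → A) × (Fin t → C)) C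
  markov : ∀ t, IsMarkovKernel (trans t)

namespace Channel

/-- Coordinates of a run of the channel: coordinate `0` is the whole input sequence, and coordinate
`t + 1` is the output with index `t`. -/
def Coord (A C : Type u) : ℕ → Type u
  | 0 => ℕ → A
  | _ + 1 => C

instance instMeasurableSpaceCoord (A C : Type u) [MeasurableSpace A] [MeasurableSpace C] :
    ∀ t, MeasurableSpace (Coord A C t)
  | 0 => inferInstanceAs (MeasurableSpace (ℕ → A))
  | _ + 1 => inferInstanceAs (MeasurableSpace C)

variable {A C : Type u}

/-- The inputs up to and including index `t` and the outputs before index `t`. -/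
def past (t : ℕ) (y : Π i : Finset.Iic t, Coord A C i) : (Fin (t + 1) → A) × (Fin t → C) :=
  (fun i => (show ℕ → A from y ⟨0, Finset.mem_Iic.2 (Nat.zero_le t)⟩) i,
    fun j => (show C from y ⟨j + 1, Finset.mem_Iic.2 j.2⟩))

/-- A run at its beginning, when only the input sequence is there. -/
def start (a : ℕ → A) : Π i : Finset.Iic 0, Coord A C i
  | ⟨0, _⟩ => a
  | ⟨_ + 1, h⟩ => absurd (Finset.mem_Iic.1 h) (Nat.not_succ_le_zero _)

/-- The outputs of a run. -/
def outputs (y : Π t, Coord A C t) : ℕ → C := fun t => y (t + 1)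

variable [MeasurableSpace A] [MeasurableSpace C]

theorem measurable_past (t : ℕ) : Measurable (past (A := A) (C := C) t) := by
  refine Measurable.prodMk (measurable_pi_lambda _ fun i => ?_) (measurable_pi_lambda _ fun j => ?_)
  · have h : Measurable fun y : (Π i : Finset.Iic t, Coord A C i) =>
        (show ℕ → A from y ⟨0, Finset.mem_Iic.2 (Nat.zero_le t)⟩) :=
      measurable_pi_apply (X := fun i : Finset.Iic t => Coord A C i)
        ⟨0, Finset.mem_Iic.2 (Nat.zero_le t)⟩
    exact (measurable_pi_apply (i : ℕ)).comp h
  · exact measurable_pi_apply (X := fun i : Finset.Iic t => Coord A C i)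
      ⟨j + 1, Finset.mem_Iic.2 j.2⟩

/-- The law of the next output, given a run so far. -/
def step (chan : Channel A C) (t : ℕ) :
    Kernel (Π i : Finset.Iic t, Coord A C i) (Coord A C (t + 1)) :=
  (chan.trans t).comap (past t) (measurable_past t)

instance instIsMarkovKernelStep (chan : Channel A C) (t : ℕ) : IsMarkovKernel (chan.step t) :=
  haveI := chan.markov t
  inferInstanceAs (IsMarkovKernel ((chan.trans t).comap (past t) (measurable_past t)))

/-- The law of the output sequence of the channel when its input sequence is `a`. -/
def law (chan : Channel A C) (a : ℕ → A) : Measure (ℕ → C) :=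
  (Kernel.traj chan.step 0 (start a)).map outputs

end Channel

/-! ### Communication of message bits -/

/-- A rate `R` communication system without feedback for the alphabets `A`, `C`, with common
randomness of law `common` on `V`. For each end-to-end delay `φ` there is a channel encoder and a
delay `φ` channel decoder. A single encoder for all delays is the case of `enc φ` not
depending on `φ`.

Indices count from `0`: `enc φ t` is the channel input at time `t + 1`, and sees the first
`⌊R (t + 1)⌋` message bits; `dec φ i` is the estimate of the `(i + 1)`-st message bit, and sees the
channel outputs at times `1, …, ⌈(i + 1) / R⌉ + φ`. -/
structure CommSystem (A C : Type u) (V : Type v) [MeasurableSpace A] [MeasurableSpace C]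
    [MeasurableSpace V] (R : ℝ) where
  common : Measure V
  common_prob : IsProbabilityMeasure common
  enc : ∀ _φ t : ℕ, (Fin ⌊R * (t + 1)⌋₊ → Bool) → V → A
  enc_measurable : ∀ φ t, Measurable (Function.uncurry (enc φ t))
  dec : ∀ φ i : ℕ, (Fin (⌈((i : ℝ) + 1) / R⌉₊ + φ) → C) → V → Bool
  dec_measurable : ∀ φ i, Measurable (Function.uncurry (dec φ i))

/-- The law of a sequence of independent fair bits. -/
def fairBits : Measure (ℕ → Bool) := Measure.infinitePi fun _ : ℕ => uniformOn Set.univ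

/-- The law of the bit sequence that consists of zeros only. -/
def zeroBits : Measure (ℕ → Bool) := Measure.dirac fun _ => false

namespace CommSystem

variable {A C : Type u} {V : Type v} [MeasurableSpace A] [MeasurableSpace C] [MeasurableSpace V]
  {R : ℝ}

/-- The channel input sequence that carries the message stream `b`. -/
def inputs (sys : CommSystem A C V R) (φ : ℕ) (b : ℕ → Bool) (x : V) : ℕ → A :=
  fun t => sys.enc φ t (fun i => b i) x

/-- The estimate of message bit `i`. -/
def received (sys : CommSystem A C V R) (φ : ℕ) (c : ℕ → C) (x : V) (i : ℕ) : Bool :=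
  sys.dec φ i (fun s => c s) x

/-- The probability that message bit `i` is decoded in error when the message stream is `b`, over
the channel noise and the common randomness. -/
def bitError (sys : CommSystem A C V R) (chan : Channel A C) (φ : ℕ) (b : ℕ → Bool) (i : ℕ) :
    ℝ≥0∞ :=
  ∫⁻ x, chan.law (sys.inputs φ b x) {c | sys.received φ c x i ≠ b i} ∂sys.common

/-- Any bit-error probability is met given a long enough delay, where the probability is over the
channel noise, the common randomness, and message bits that are independent fair coin tosses. -/
def Reliable (sys : CommSystem A C V R) (chan : Channel A C) : Prop :=
  ∀ ε : ℝ≥0∞, 0 < ε → ∃ φ₀ : ℕ, ∀ φ ≥ φ₀, ∀ i, ∫⁻ b, sys.bitError chan φ b i ∂fairBits ≤ ε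

/-- Any bit-error probability is met given a long enough delay, for every realization of the message
bits. -/
def UniformlyReliable (sys : CommSystem A C V R) (chan : Channel A C) : Prop :=
  ∀ ε : ℝ≥0∞, 0 < ε → ∃ φ₀ : ℕ, ∀ φ ≥ φ₀, ∀ b i, sys.bitError chan φ b i ≤ ε

end CommSystem

/-! ### The code over the noisy channel -/

section EndToEnd

variable {A C : Type u} {V : Type v} [MeasurableSpace A] [MeasurableSpace C] [MeasurableSpace V]
  {R : ℝ} (src : Source) (code : Code) (chan : Channel A C) (sys : CommSystem A C V R) (φ : ℕ)

/-- The channel inputs that carry the historical stream, XORed with the mask `r`. -/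
def channelInputs (ω : Outcome) (r : ℕ → Bool) (x : V) : ℕ → A :=
  sys.inputs φ (fun p => xor (historyStream src code ω p) (r p)) x

/-- The historical bits of superblock `m` as recovered from the channel outputs. -/
def receivedBits (r : ℕ → Bool) (x : V) (c : ℕ → C) (m : ℕ) : Fin code.K → Bool :=
  fun j => xor (sys.received φ c x (position code m j)) (r (position code m j))

/-- The end-to-end reconstruction of `X_t`. -/
def endToEndEstimate (ω : Outcome) (r : ℕ → Bool) (x : V) (c : ℕ → C) (t : ℕ) : ℝ :=
  estimate src code ω (receivedBits code sys φ r x c (superblockOf code ω t)) t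

/-- The expected end-to-end distortion `E|X_t - X̂_t|^η` when the historical stream, masked by a
common random bit sequence of law `mask`, is carried over the channel. The source, the mask, the
common randomness of the communication system, and the channel noise are independent. -/
def endToEndDistortion (η : ℝ) (mask : Measure (ℕ → Bool)) (t : ℕ) : ℝ≥0∞ :=
  ∫⁻ ω, ∫⁻ r, ∫⁻ x, ∫⁻ c,
    distortion η (process src.lam ω t) (endToEndEstimate src code sys φ ω r x c t)
      ∂(chan.law (channelInputs src code sys φ ω r x)) ∂sys.common ∂mask ∂(sourceLaw src code)

/-- The whole system is causal with end-to-end delay `d`: the channel input at time `s + 1` is not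
affected by the source after time `s + 1` (for the offsets that occur), and the reconstruction of `X_t` is not affected by the
channel outputs after time `t + d`. -/
def CausalWithDelay (d : ℕ) : Prop :=
  (∀ (ω ω' : Outcome) (r : ℕ → Bool) (x : V) (s : ℕ), offset ω < code.len → ω.2.2 = ω'.2.2 →
    (∀ t ≤ s + 1, process src.lam ω t = process src.lam ω' t) →
      channelInputs src code sys φ ω r x s = channelInputs src code sys φ ω' r x s) ∧
  (∀ (ω : Outcome) (r : ℕ → Bool) (x : V) (c c' : ℕ → C) (t : ℕ),
    (∀ s < t + d, c s = c' s) →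
      endToEndEstimate src code sys φ ω r x c t = endToEndEstimate src code sys φ ω r x c' t)

end EndToEnd

/-- `a` and `b` differ by at most `δ`. -/
def Close (a b δ : ℝ≥0∞) : Prop := a ≤ b + δ ∧ b ≤ a + δ

end

end TwoStream

/-!
The argument separates the source from the channel.

**Channel.** Fix the outcome of the source, hence the historical stream. A fair mask turns this one
stream into fair message bits (`map_xor_fairBits`), so whether the system is reliable for fair bits
or for all realizations, each historical bit is wrong with probability at most `ε`, once the delay
is long enough, *for every source outcome* (`exists_maskedError_le`). Given the source outcome the
distortion at time `t` depends on the channel only through the `K` bits handed to the decoder of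
one superblock. By the union bound the channel therefore changes the expected distortion by at most
`Kε` times the sum over all bit strings `b` of the distortion with `b` fixed
(`endToEndDistortion_close`).

**Source.** It remains to bound the distortion with fixed bits uniformly in `t`, although the
source itself grows without bound. The errors of the dithered checkpoints are iid uniform and
independent of the source (`map_residual_uniformLaw`), and the normalized histories and the side
information of a superblock are functions of these errors and of the driving noise alone. So all
superblocks have the same law, whatever the offset (`measurePreserving_ofDrive_drive`), and time
enters only through the place within the superblock, of which there are finitely many
(`lintegral_ruleError_le`).

**Truncation.** The normalized histories are bounded (`exists_abs_history_le`), so with truncated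
values the distortion with fixed bits is always finite. Beyond that bound truncation does not
increase the distortion, and its loss tends to `0` by dominated convergence at each of the finitely
many places (`exists_level_close`).

**Delay.** The filler of two superblock lengths ensures that a superblock is over before its first
bit is due, and one more superblock length covers the bits themselves (`causalWithDelay`).
-/

namespace TwoStream

/-! ### Subtractive dither -/

/-- The error `x - Q_Δ(x)` of the uniform quantizer. -/
noncomputable def residual (Δ x : ℝ) : ℝ := x - quantize Δ x

theorem measurable_quantize (Δ : ℝ) : Measurable (quantize Δ) := by
  have h : (quantize Δ) = fun x : ℝ => Δ * ((⌊x / Δ + 1 / 2⌋ : ℤ) : ℝ) := by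
    funext x; simp only [quantize, round_eq]
  rw [h]
  have h1 : Measurable fun x : ℝ => ⌊x / Δ + 1 / 2⌋ :=
    Int.measurable_floor.comp ((measurable_id.div_const Δ).add_const _)
  exact ((measurable_from_top (f := fun z : ℤ => (z : ℝ))).comp h1).const_mul Δ

theorem measurable_residual (Δ : ℝ) : Measurable (residual Δ) :=
  measurable_id.sub (measurable_quantize Δ)

theorem abs_residual_le {Δ : ℝ} (hΔ : 0 < Δ) (x : ℝ) : |residual Δ x| ≤ Δ / 2 := by
  have h : residual Δ x = Δ * (x / Δ - round (x / Δ)) := by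
    simp only [residual, quantize]; field_simp
  rw [h, abs_mul, abs_of_pos hΔ]
  nlinarith [abs_sub_round (x / Δ)]

theorem residual_of_mem_Ico {Δ : ℝ} (hΔ : 0 < Δ) {x : ℝ} (hx : x ∈ Set.Ico (-Δ / 2) (Δ / 2)) :
    residual Δ x = x := by
  have h : round (x / Δ) = 0 := by
    rw [round_eq_zero_iff]
    constructor
    · rw [le_div_iff₀ hΔ]; linarith [hx.1]
    · rw [div_lt_iff₀ hΔ]; linarith [hx.2]
  simp [residual, quantize, h]

theorem residual_add_zsmul {Δ : ℝ} (hΔ : 0 < Δ) (k : ℤ) (x : ℝ) :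
    residual Δ (k • Δ + x) = residual Δ x := by
  have h : (k • Δ + x) / Δ = x / Δ + k := by
    rw [zsmul_eq_mul]; field_simp; ring
  simp only [residual, quantize, h, round_add_intCast]
  push_cast
  rw [zsmul_eq_mul]; ring

theorem isProbabilityMeasure_uniformLaw {a : ℝ} (ha : 0 < a) :
    IsProbabilityMeasure (uniformLaw a) := by
  have h : volume (Set.Icc (-a / 2) (a / 2)) = ENNReal.ofReal a := by
    rw [Real.volume_Icc]; congr 1; ring
  refine cond_isProbabilityMeasure_of_finite ?_ ?_ <;> rw [h]
  · simpa using ha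
  · exact ENNReal.ofReal_ne_top

/-- The error of a dithered quantizer is uniform whatever the quantizer input is: as a function of
the dither, `residual Δ (x + θ)` runs once through a period of the `Δ`-periodic function
`residual Δ`. -/
theorem map_residual_uniformLaw {Δ : ℝ} (hΔ : 0 < Δ) (x : ℝ) :
    (uniformLaw Δ).map (fun θ => residual Δ (x + θ)) = uniformLaw Δ := by
  have hm : Measurable fun θ => residual Δ (x + θ) :=
    (measurable_residual Δ).comp (measurable_const_add x)
  refine Measure.ext_of_lintegral _ fun f hf => ?_
  rw [lintegral_map hf hm, uniformLaw, ProbabilityTheory.cond, lintegral_smul_measure,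
    lintegral_smul_measure]
  congr 1
  have hper : ∀ (g : AddSubgroup.zmultiples Δ) (y : ℝ),
      f (residual Δ (g +ᵥ y)) = f (residual Δ y) := by
    rintro ⟨g, k, rfl⟩ y
    exact congrArg f (residual_add_zsmul hΔ k y)
  calc ∫⁻ θ in Set.Icc (-Δ / 2) (Δ / 2), f (residual Δ (x + θ))
      = ∫⁻ θ in Set.Ioc (-Δ / 2) (Δ / 2), f (residual Δ (x + θ)) :=
        (setLIntegral_congr Ioc_ae_eq_Icc).symm
    _ = ∫⁻ y in Set.Ioc (x + -Δ / 2) (x + -Δ / 2 + Δ), f (residual Δ y) := by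
        have h := (measurePreserving_add_left (volume : Measure ℝ) x).setLIntegral_comp_preimage_emb
          (measurableEmbedding_addLeft x) (fun y => f (residual Δ y))
          (Set.Ioc (x + -Δ / 2) (x + -Δ / 2 + Δ))
        rw [← h]
        congr 2
        rw [Set.preimage_const_add_Ioc]
        congr 1 <;> ring
    _ = ∫⁻ y in Set.Ioc (-Δ / 2) (-Δ / 2 + Δ), f (residual Δ y) :=
        (isAddFundamentalDomain_Ioc hΔ _).setLIntegral_eq (isAddFundamentalDomain_Ioc hΔ _) _ hper
    _ = ∫⁻ y in Set.Ico (-Δ / 2) (Δ / 2), f (residual Δ y) := by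
        rw [show -Δ / 2 + Δ = Δ / 2 by ring]
        exact setLIntegral_congr (Ico_ae_eq_Ioc).symm
    _ = ∫⁻ y in Set.Ico (-Δ / 2) (Δ / 2), f y :=
        setLIntegral_congr_fun measurableSet_Ico fun y hy => by
          simp only [residual_of_mem_Ico hΔ hy]
    _ = ∫⁻ y in Set.Icc (-Δ / 2) (Δ / 2), f y := setLIntegral_congr Ico_ae_eq_Icc

/-- A time shift preserves an iid law on sequences. -/
theorem measurePreserving_shift {α : Type*} [MeasurableSpace α] (μ : Measure α)
    [IsProbabilityMeasure μ] (s : ℕ) :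
    MeasurePreserving (fun (w : ℕ → α) j => w (s + j))
      (Measure.infinitePi fun _ : ℕ => μ) (Measure.infinitePi fun _ : ℕ => μ) := by
  have hm : Measurable fun (w : ℕ → α) (j : ℕ) => w (s + j) := by fun_prop
  refine ⟨hm, Measure.eq_infinitePi _ fun F t ht => ?_⟩
  rw [Measure.map_apply hm (.pi F.countable_toSet fun _ _ => ht _)]
  have hset : (fun (w : ℕ → α) (j : ℕ) => w (s + j)) ⁻¹' (F : Set ℕ).pi t =
      ((F.image (s + ·) : Finset ℕ) : Set ℕ).pi fun i => t (i - s) := by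
    ext w; simp [Set.mem_pi]
  rw [hset, Measure.infinitePi_pi _ fun i _ => ht _,
    Finset.prod_image fun a _ b _ h => Nat.add_left_cancel h]
  simp

theorem measurePreserving_residual {Δ : ℝ} (hΔ : 0 < Δ) (x : ℕ → ℝ) (s : ℕ) :
    MeasurePreserving (fun (θ : ℕ → ℝ) j => residual Δ (x j + θ (s + j)))
      (Measure.infinitePi fun _ : ℕ => uniformLaw Δ)
      (Measure.infinitePi fun _ : ℕ => uniformLaw Δ) := by
  have := isProbabilityMeasure_uniformLaw hΔ
  have hf : ∀ j, Measurable fun θ => residual Δ (x j + θ) := fun j =>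
    (measurable_residual Δ).comp (measurable_const_add (x j))
  have h : MeasurePreserving (fun (θ : ℕ → ℝ) j => residual Δ (x j + θ j))
      (Measure.infinitePi fun _ : ℕ => uniformLaw Δ)
      (Measure.infinitePi fun _ : ℕ => uniformLaw Δ) := by
    refine ⟨measurable_pi_lambda _ fun j => (hf j).comp (measurable_pi_apply j), ?_⟩
    rw [Measure.infinitePi_map_pi _ hf]
    simp only [map_residual_uniformLaw hΔ]
  exact h.comp (measurePreserving_shift (uniformLaw Δ) s)

/-! ### Stationarity of the superblocks -/

section Stationarity

/-- The first-order recursion `v ↦ lam * v + w_i`, started at `v = a`. -/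
def driven (lam a : ℝ) (w : ℕ → ℝ) : ℕ → ℝ
  | 0 => a
  | i + 1 => lam * driven lam a w i + w i

theorem process_add (lam : ℝ) (ω : Outcome) (s : ℕ) (y : ℝ) (i : ℕ) :
    process lam ω (s + i) - lam ^ i * y =
      driven lam (process lam ω s - y) (fun j => ω.2.1 (s + j)) i := by
  induction i with
  | zero => simp [driven]
  | succ i ih =>
    rw [driven, ← ih, ← add_assoc, process]; ring

theorem measurable_driven (lam : ℝ) (i : ℕ) :
    Measurable fun p : ℝ × (ℕ → ℝ) => driven lam p.1 p.2 i := by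
  induction i with
  | zero => exact measurable_fst
  | succ i ih =>
    exact (ih.const_mul lam).add ((measurable_pi_apply i).comp measurable_snd)

theorem measurable_process (lam : ℝ) (t : ℕ) : Measurable fun ω : Outcome => process lam ω t := by
  induction t with
  | zero => exact measurable_fst
  | succ t ih =>
    exact (ih.const_mul lam).add ((measurable_pi_apply t).comp (measurable_fst.comp measurable_snd))

theorem process_congr (lam : ℝ) {ω ω' : Outcome} (h0 : ω.1 = ω'.1) (hw : ω.2.1 = ω'.2.1) (t : ℕ) :
    process lam ω t = process lam ω' t := by
  induction t with
  | zero => exact h0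
  | succ t ih => simp only [process, ih, hw]

theorem exists_abs_driven_le (lam a B : ℝ) (i : ℕ) :
    ∃ b, ∀ v (w : ℕ → ℝ), |v| ≤ a → (∀ j, |w j| ≤ B) → |driven lam v w i| ≤ b := by
  induction i with
  | zero => exact ⟨a, fun v w hv _ => hv⟩
  | succ i ih =>
    obtain ⟨b, hb⟩ := ih
    refine ⟨|lam| * b + B, fun v w hv hw => ?_⟩
    rw [driven]
    refine (abs_add_le _ _).trans (add_le_add ?_ (hw i))
    rw [abs_mul]
    exact mul_le_mul_of_nonneg_left (hb v w hv hw) (abs_nonneg _)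

/-- What drives the code from some time on: the noise, the errors of the opening checkpoints, the
errors of the closing checkpoints, and the offset. -/
abbrev Drive : Type := (ℕ → ℝ) × (ℕ → ℝ) × (ℕ → ℝ) × ℕ

/-- The data of a superblock: its normalized histories `(X̃_{k,i})` and side information `(Z_k)`. -/
abbrev Superblock (code : Code) : Type := (Fin code.M → Fin code.n → ℝ) × (Fin code.M → ℝ)

/-- The drive from time `s` on. -/
noncomputable def drive (src : Source) (code : Code) (s : ℕ) (ω : Outcome) : Drive :=
  (fun j => ω.2.1 (s + j),
    fun j => residual code.Δ (process src.lam ω (s + j) + dither ω (s + j)),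
    fun j => residual code.Δ (process src.lam ω (s + j) + ditherEnd ω (s + j)),
    offset ω)

/-- The superblock with a given drive. Only checkpoint errors enter, not the state `X_s` at which
the superblock opens. -/
def ofDrive (src : Source) (code : Code) (p : Drive) : Superblock code :=
  (fun k i => driven src.lam (p.2.1 (k * code.n)) (fun j => p.1 (k * code.n + j)) i,
    fun k => driven src.lam (p.2.1 (k * code.n)) (fun j => p.1 (k * code.n + j)) (code.n - 1) -
      p.2.2.1 (k * code.n + (code.n - 1)))

/-- The data of superblock `m`. -/
noncomputable def superblock (src : Source) (code : Code) (m : ℕ) (ω : Outcome) : Superblock code :=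
  (fun k i => history src code ω (m * code.M + k) i, fun k => sideInfo src code ω (m * code.M + k))

/-- The law of the drive: noise, checkpoint errors and offset are independent, and the checkpoint
errors are iid uniform. -/
noncomputable def driveLaw (src : Source) (code : Code) : Measure Drive :=
  (Measure.infinitePi fun _ : ℕ => src.noise).prod
    ((Measure.infinitePi fun _ : ℕ => uniformLaw code.Δ).prod
      ((Measure.infinitePi fun _ : ℕ => uniformLaw code.Δ).prod
        (uniformOn (Set.Iio code.len))))

/-- The law of a superblock. -/
noncomputable def superblockLaw (src : Source) (code : Code) : Measure (Superblock code) :=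
  (driveLaw src code).map (ofDrive src code)

theorem Code.len_pos (code : Code) : 0 < code.len := Nat.mul_pos code.n_pos code.M_pos

variable (src : Source) (code : Code)

theorem isProbabilityMeasure_offsetLaw :
    IsProbabilityMeasure (uniformOn (Set.Iio code.len) : Measure ℕ) :=
  isProbabilityMeasure_uniformOn (Set.finite_Iio _) ⟨0, code.len_pos⟩

theorem isProbabilityMeasure_driveLaw : IsProbabilityMeasure (driveLaw src code) := by
  have := isProbabilityMeasure_uniformLaw code.Δ_pos
  have := src.noise_prob
  have := isProbabilityMeasure_offsetLaw code
  unfold driveLaw; infer_instance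

theorem isProbabilityMeasure_sourceLaw : IsProbabilityMeasure (sourceLaw src code) := by
  have := isProbabilityMeasure_uniformLaw code.Δ_pos
  have := isProbabilityMeasure_uniformLaw src.width_pos
  have := src.noise_prob
  have := isProbabilityMeasure_offsetLaw code
  unfold sourceLaw; infer_instance

theorem measurable_drive (s : ℕ) : Measurable (drive src code s) := by
  refine .prodMk (by fun_prop) (.prodMk ?_ (.prodMk ?_ (by unfold offset; fun_prop))) <;>
    refine measurable_pi_lambda _ fun j => (measurable_residual _).comp ?_ <;>
    refine (measurable_process _ _).add ?_
  · unfold dither; fun_prop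
  · unfold ditherEnd; fun_prop

/-- Whatever the time `s`, the drive from `s` on has the same law: given `X_0` and the noise, the
checkpoint errors are iid uniform by `map_residual_uniformLaw`. -/
theorem measurePreserving_drive (s : ℕ) :
    MeasurePreserving (drive src code s) (sourceLaw src code) (driveLaw src code) := by
  have := isProbabilityMeasure_uniformLaw code.Δ_pos
  have := isProbabilityMeasure_uniformLaw src.width_pos
  have := src.noise_prob
  have := isProbabilityMeasure_offsetLaw code
  have hm := measurable_drive src code s
  have hfix : ∀ x₀ : ℝ, MeasurePreserving (fun y => drive src code s (x₀, y))
      ((Measure.infinitePi fun _ : ℕ => src.noise).prod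
      ((Measure.infinitePi fun _ : ℕ => uniformLaw code.Δ).prod
        ((Measure.infinitePi fun _ : ℕ => uniformLaw code.Δ).prod
          (uniformOn (Set.Iio code.len))))) (driveLaw src code) := by
    intro x₀
    refine (measurePreserving_shift src.noise s).skew_product
      (g := fun w y => (drive src code s (x₀, w, y)).2)
      (hm.snd.comp measurable_prodMk_left) (ae_of_all _ fun w => ?_)
    -- the process does not depend on the dithers
    let x : ℕ → ℝ := process src.lam (x₀, w, 0, 0, 0)
    have hx : ∀ y t, process src.lam (x₀, w, y) t = x t := fun y t =>
      process_congr (ω := (x₀, w, y)) (ω' := (x₀, w, 0, 0, 0)) _ rfl rfl t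
    have hU := measurePreserving_residual code.Δ_pos (fun j => x (s + j)) s
    convert! (hU.prod (hU.prod (MeasurePreserving.id
      (uniformOn (Set.Iio code.len) : Measure ℕ)))).map_eq using 2
    funext y
    simp only [drive, hx]
    rfl
  have h := (MeasurePreserving.id (uniformLaw src.width)).skew_product (μc :=
    (Measure.infinitePi fun _ : ℕ => src.noise).prod
      ((Measure.infinitePi fun _ : ℕ => uniformLaw code.Δ).prod
        ((Measure.infinitePi fun _ : ℕ => uniformLaw code.Δ).prod
          (uniformOn (Set.Iio code.len))))) (g := fun x₀ y => drive src code s (x₀, y))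
      hm (ae_of_all _ fun x₀ => (hfix x₀).map_eq)
  have := isProbabilityMeasure_driveLaw src code
  exact measurePreserving_snd.comp h

theorem measurable_ofDrive : Measurable (ofDrive src code) := by
  have h : ∀ k i : ℕ, Measurable fun p : Drive =>
      driven src.lam (p.2.1 (k * code.n)) (fun j => p.1 (k * code.n + j)) i := fun k i =>
    (measurable_driven src.lam i).comp (f := fun p : Drive =>
      (p.2.1 (k * code.n), fun j => p.1 (k * code.n + j))) (by fun_prop)
  exact .prodMk (measurable_pi_lambda _ fun k => measurable_pi_lambda _ fun i => h k i)
    (measurable_pi_lambda _ fun k => (h k _).sub (by fun_prop))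

theorem measurePreserving_ofDrive_drive (s : ℕ) :
    MeasurePreserving (fun ω => ofDrive src code (drive src code s ω))
      (sourceLaw src code) (superblockLaw src code) :=
  (measurable_ofDrive src code).measurePreserving _ |>.comp (measurePreserving_drive src code s)

theorem history_eq_driven (ω : Outcome) (k i : ℕ) :
    history src code ω k i = driven src.lam
      (residual code.Δ (process src.lam ω (blockStart code ω k) + dither ω (blockStart code ω k)))
      (fun j => ω.2.1 (blockStart code ω k + j)) i := by
  rw [history, process_add]
  congr 1
  simp only [checkpoint, residual]; ring

theorem superblock_eq (m : ℕ) (ω : Outcome) :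
    superblock src code m ω = ofDrive src code (drive src code (offset ω + m * code.len) ω) := by
  have hs : ∀ k : ℕ, blockStart code ω (m * code.M + k) =
      offset ω + m * code.len + k * code.n := fun k => by
    simp only [blockStart, Code.len]; ring
  refine Prod.ext ?_ ?_
  · funext k i
    simp only [superblock, ofDrive, drive, history_eq_driven, hs, add_assoc]
  · funext k
    have h : sideInfo src code ω (m * code.M + k) =
        history src code ω (m * code.M + k) (code.n - 1) -
          residual code.Δ (process src.lam ω (blockStart code ω (m * code.M + k) + (code.n - 1)) +
            ditherEnd ω (blockStart code ω (m * code.M + k) + (code.n - 1))) := by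
      simp only [sideInfo, history, checkpointEnd, residual]; ring
    simp only [superblock, ofDrive, drive]
    rw [h]
    simp only [history_eq_driven, hs, add_assoc]

end Stationarity

/-! ### Distortion of reconstruction rules, uniformly in time -/

section Rules

/-- A reconstruction rule: values `T_{k,i}` that may depend on the whole superblock. -/
abbrev Rule (code : Code) : Type := Superblock code → Fin code.M → Fin code.n → ℝ

/-- The rule of a code whose decoder is handed the bits `β y` for the superblock `y`. -/
def Code.rule (code : Code) (β : Superblock code → Fin code.K → Bool) : Rule code :=
  fun y => code.recon (β y) y.2

/-- The block within its superblock, and the place within its block, of the source symbol `r` time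
steps after the offset. -/
def Code.place (code : Code) (r : ℕ) : Fin code.M × Fin code.n :=
  (⟨r / code.n % code.M, Nat.mod_lt _ code.M_pos⟩, ⟨r % code.n, Nat.mod_lt _ code.n_pos⟩)

/-- The distortion of the rule `g` at place `p` of the superblock `y`. -/
noncomputable def placeError {code : Code} (η : ℝ) (g : Rule code) (p : Fin code.M × Fin code.n)
    (y : Superblock code) : ℝ≥0∞ :=
  distortion η (y.1 p.1 p.2) (g y p.1 p.2)

variable (src : Source) (code : Code)

/-- The distortion at time `t` when the rule `g` is used. -/
noncomputable def ruleError (η : ℝ) (g : Rule code) (t : ℕ) (ω : Outcome) : ℝ≥0∞ :=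
  if t < offset ω then distortion η (process src.lam ω t) (checkpoint src code ω t)
  else placeError η g (code.place (t - offset ω)) (superblock src code (superblockOf code ω t) ω)

variable {src code}

theorem measurable_distortion (η : ℝ) : Measurable fun p : ℝ × ℝ => distortion η p.1 p.2 := by
  unfold distortion
  have h : Measurable fun p : ℝ × ℝ => |p.1 - p.2| := by
    simp only [← Real.norm_eq_abs]; fun_prop
  exact (h.pow_const η).ennreal_ofReal

theorem distortion_le_of_abs_sub_le {η x y x' y' : ℝ} (hη : 0 ≤ η) (h : |x - y| ≤ |x' - y'|) :
    distortion η x y ≤ distortion η x' y' :=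
  ENNReal.ofReal_le_ofReal (Real.rpow_le_rpow (abs_nonneg _) h hη)

theorem measurable_rule {β : Superblock code → Fin code.K → Bool} (hβ : Measurable β) :
    Measurable (code.rule β) := by
  have h : Measurable fun p : (Fin code.K → Bool) × (Fin code.M → ℝ) => code.recon p.1 p.2 :=
    measurable_from_prod_countable_right code.recon_measurable
  exact h.comp (hβ.prodMk measurable_snd)

theorem measurable_placeError (η : ℝ) {g : Rule code} (hg : Measurable g)
    (p : Fin code.M × Fin code.n) : Measurable (placeError η g p) :=
  (measurable_distortion η).comp (f := fun y : Superblock code => (y.1 p.1 p.2, g y p.1 p.2))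
    (.prodMk (by fun_prop)
      ((measurable_pi_apply p.2).comp ((measurable_pi_apply p.1).comp hg)))

theorem superblock_superblockOf (ω : Outcome) (t : ℕ) :
    superblock src code (superblockOf code ω t) ω =
      ofDrive src code (drive src code (offset ω + (t - offset ω) / code.len * code.len) ω) :=
  superblock_eq src code _ ω

theorem distortion_estimate (η : ℝ) (β : Superblock code → Fin code.K → Bool) (t : ℕ)
    (ω : Outcome) :
    distortion η (process src.lam ω t)
        (estimate src code ω (β (superblock src code (superblockOf code ω t) ω)) t) =
      ruleError src code η (code.rule β) t ω := by
  unfold ruleError estimate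
  split_ifs with h
  · rfl
  have ht : superblockOf code ω t * code.M + (t - offset ω) / code.n % code.M =
      (t - offset ω) / code.n := by
    rw [superblockOf, Code.len, ← Nat.div_div_eq_div_mul]
    exact Nat.div_add_mod' _ _
  have ht' : blockStart code ω ((t - offset ω) / code.n) + (t - offset ω) % code.n = t := by
    have := Nat.div_add_mod' (t - offset ω) code.n
    simp only [blockStart]; omega
  simp only [placeError, Code.place, Code.rule, distortion, superblock, history, ht, ht']
  congr 3
  ring

theorem measurable_ruleError (η : ℝ) {g : Rule code} (hg : Measurable g) (t : ℕ) :
    Measurable (ruleError src code η g t) := by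
  have hT : Measurable offset :=
    measurable_snd.comp (measurable_snd.comp (measurable_snd.comp measurable_snd))
  -- the offset takes countably many values, so it may be treated as a parameter
  have h : Measurable fun p : ℕ × Outcome =>
      if t < p.1 then distortion η (process src.lam p.2 t) (checkpoint src code p.2 t)
      else placeError η g (code.place (t - p.1)) (ofDrive src code
        (drive src code (p.1 + (t - p.1) / code.len * code.len) p.2)) := by
    refine measurable_from_prod_countable_right fun τ => ?_
    by_cases hτ : t < τ
    · simp only [hτ, if_true]
      refine (measurable_distortion η).comp ((measurable_process _ t).prodMk ?_)
      have hd : Measurable fun ω => dither ω t := by unfold dither; fun_prop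
      exact ((measurable_quantize _).comp ((measurable_process _ t).add hd)).sub hd
    · simp only [hτ, if_false]
      exact (measurable_placeError η hg _).comp
        ((measurable_ofDrive src code).comp (measurable_drive src code _))
  convert h.comp (hT.prodMk measurable_id) using 1
  funext ω
  simp only [ruleError, superblock_superblockOf, Function.comp, id]

theorem ae_offset_lt (src : Source) (code : Code) :
    ∀ᵐ ω ∂(sourceLaw src code), offset ω < code.len := by
  have := isProbabilityMeasure_uniformLaw code.Δ_pos
  have := isProbabilityMeasure_offsetLaw code
  have := src.noise_prob
  have hd : MeasurePreserving (fun q : Drive => q.2.2.2) (driveLaw src code)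
      (uniformOn (Set.Iio code.len) : Measure ℕ) :=
    (measurePreserving_snd.comp measurePreserving_snd).comp measurePreserving_snd
  have h : MeasurePreserving offset (sourceLaw src code)
      (uniformOn (Set.Iio code.len) : Measure ℕ) :=
    MeasurePreserving.comp (g := fun q : Drive => q.2.2.2) (f := drive src code 0) hd
      (measurePreserving_drive src code 0)
  exact h.quasiMeasurePreserving.ae (ae_cond_mem measurableSet_Iio)

/-- The sum over all possible offsets of the values of `f` at the place and the superblock that
time `t` would have. -/
noncomputable def offsetSum (src : Source) (code : Code)
    (f : Fin code.M × Fin code.n → Superblock code → ℝ≥0∞) (t : ℕ) (ω : Outcome) : ℝ≥0∞ :=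
  ∑ τ ∈ Finset.range code.len, f (code.place (t - τ))
    (ofDrive src code (drive src code (τ + (t - τ) / code.len * code.len) ω))

theorem le_offsetSum (f : Fin code.M × Fin code.n → Superblock code → ℝ≥0∞) (t : ℕ) {ω : Outcome}
    (hω : offset ω < code.len) :
    f (code.place (t - offset ω)) (superblock src code (superblockOf code ω t) ω) ≤
      offsetSum src code f t ω := by
  rw [superblock_superblockOf]
  exact Finset.single_le_sum (f := fun τ => f (code.place (t - τ))
    (ofDrive src code (drive src code (τ + (t - τ) / code.len * code.len) ω)))
    (fun _ _ => zero_le) (Finset.mem_range.2 hω)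

theorem measurable_offsetSum {f : Fin code.M × Fin code.n → Superblock code → ℝ≥0∞}
    (hf : ∀ p, Measurable (f p)) (t : ℕ) : Measurable (offsetSum src code f t) :=
  Finset.measurable_fun_sum _ fun _ _ =>
    (hf _).comp ((measurable_ofDrive src code).comp (measurable_drive src code _))

theorem lintegral_offsetSum_le {f : Fin code.M × Fin code.n → Superblock code → ℝ≥0∞}
    (hf : ∀ p, Measurable (f p)) (t : ℕ) :
    ∫⁻ ω, offsetSum src code f t ω ∂(sourceLaw src code) ≤
      code.len * ∑ p, ∫⁻ y, f p y ∂(superblockLaw src code) := by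
  have hm : ∀ τ ∈ Finset.range code.len, Measurable fun ω => f (code.place (t - τ))
      (ofDrive src code (drive src code (τ + (t - τ) / code.len * code.len) ω)) := fun τ _ =>
    (hf _).comp ((measurable_ofDrive src code).comp (measurable_drive src code _))
  unfold offsetSum
  rw [lintegral_finsetSum _ hm]
  have h : ∀ τ ∈ Finset.range code.len, ∫⁻ ω, f (code.place (t - τ)) (ofDrive src code
      (drive src code (τ + (t - τ) / code.len * code.len) ω)) ∂(sourceLaw src code) ≤
      ∑ p, ∫⁻ y, f p y ∂(superblockLaw src code) := fun τ _ => by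
    rw [(measurePreserving_ofDrive_drive src code _).lintegral_comp (hf _)]
    exact Finset.single_le_sum (f := fun p => ∫⁻ y, f p y ∂(superblockLaw src code))
      (fun _ _ => zero_le) (Finset.mem_univ _)
  simpa using Finset.sum_le_card_nsmul _ _ _ h

theorem distortion_checkpoint_le {η : ℝ} (hη : 0 ≤ η) (t : ℕ) (ω : Outcome) :
    distortion η (process src.lam ω t) (checkpoint src code ω t) ≤
      ENNReal.ofReal ((code.Δ / 2) ^ η) := by
  refine ENNReal.ofReal_le_ofReal (Real.rpow_le_rpow (abs_nonneg _) ?_ hη)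
  convert abs_residual_le code.Δ_pos (process src.lam ω t + dither ω t) using 2
  simp only [checkpoint, residual]; ring

/-- The expected distortion of a rule is bounded uniformly in time: up to the offset, time enters
only through the place in the superblock. -/
theorem lintegral_ruleError_le {η : ℝ} (hη : 0 ≤ η) {g : Rule code} (hg : Measurable g) (t : ℕ) :
    ∫⁻ ω, ruleError src code η g t ω ∂(sourceLaw src code) ≤
      ENNReal.ofReal ((code.Δ / 2) ^ η) +
        code.len * ∑ p, ∫⁻ y, placeError η g p y ∂(superblockLaw src code) := by
  have := isProbabilityMeasure_sourceLaw src code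
  calc ∫⁻ ω, ruleError src code η g t ω ∂(sourceLaw src code)
      ≤ ∫⁻ ω, (ENNReal.ofReal ((code.Δ / 2) ^ η) + offsetSum src code (placeError η g) t ω)
          ∂(sourceLaw src code) := by
        refine lintegral_mono_ae ((ae_offset_lt src code).mono fun ω hω => ?_)
        unfold ruleError
        split_ifs with h
        · exact (distortion_checkpoint_le hη t ω).trans le_self_add
        · exact (le_offsetSum (placeError η g) t hω).trans le_add_self
    _ ≤ _ := by
        rw [lintegral_add_left measurable_const, lintegral_const, measure_univ, mul_one]
        gcongr
        exact lintegral_offsetSum_le (measurable_placeError η hg) t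

/-- Two rules whose errors are close at every place of a superblock have close distortions,
uniformly in time. -/
theorem lintegral_ruleError_le_add {η : ℝ} {g g' : Rule code} (hg : Measurable g)
    (hg' : Measurable g') (t : ℕ) :
    ∫⁻ ω, ruleError src code η g t ω ∂(sourceLaw src code) ≤
      ∫⁻ ω, ruleError src code η g' t ω ∂(sourceLaw src code) +
        code.len * ∑ p, ∫⁻ y, (placeError η g p y - placeError η g' p y)
          ∂(superblockLaw src code) := by
  have hf : ∀ p, Measurable fun y => placeError η g p y - placeError η g' p y := fun p =>
    (measurable_placeError η hg p).sub (measurable_placeError η hg' p)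
  calc ∫⁻ ω, ruleError src code η g t ω ∂(sourceLaw src code)
      ≤ ∫⁻ ω, (ruleError src code η g' t ω + offsetSum src code
          (fun p y => placeError η g p y - placeError η g' p y) t ω) ∂(sourceLaw src code) := by
        refine lintegral_mono_ae ((ae_offset_lt src code).mono fun ω hω => ?_)
        unfold ruleError
        split_ifs with h
        · exact le_self_add
        · exact le_add_tsub.trans (add_le_add le_rfl
            (le_offsetSum (fun p y => placeError η g p y - placeError η g' p y) t hω))
    _ ≤ _ := by
        rw [lintegral_add_right _ (measurable_offsetSum hf t)]
        gcongr
        exact lintegral_offsetSum_le hf t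

/-- If the distortion of a rule is finite at all times, then so is its error at every place of a
superblock: with positive probability the offset is `0`, and then the place is met at a time
before `nM`. -/
theorem lintegral_placeError_ne_top {η : ℝ} {g : Rule code} (hg : Measurable g)
    (h : ∀ t, ∫⁻ ω, ruleError src code η g t ω ∂(sourceLaw src code) ≠ ∞)
    (p : Fin code.M × Fin code.n) :
    ∫⁻ y, placeError η g p y ∂(superblockLaw src code) ≠ ∞ := by
  have := isProbabilityMeasure_uniformLaw code.Δ_pos
  have := isProbabilityMeasure_offsetLaw code
  have := src.noise_prob
  obtain ⟨k, i⟩ := p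
  set t : ℕ := k * code.n + i with ht
  have hdiv : t / code.n = k := by
    rw [ht, add_comm, Nat.add_mul_div_right _ _ code.n_pos, Nat.div_eq_of_lt i.2, zero_add]
  have hplace : code.place t = (k, i) := by
    refine Prod.ext (Fin.ext ?_) (Fin.ext ?_)
    · simp [Code.place, hdiv, Nat.mod_eq_of_lt k.2]
    · simp [Code.place, ht, Nat.mod_eq_of_lt i.2]
  have hlen : t / code.len = 0 := by
    rw [Code.len, ← Nat.div_div_eq_div_mul, hdiv, Nat.div_eq_of_lt k.2]
  set f : Superblock code → ℝ≥0∞ := placeError η g (k, i) with hf_def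
  have hf : Measurable f := measurable_placeError η hg (k, i)
  have hF : Measurable fun q : Drive => f (ofDrive src code q) :=
    hf.comp (measurable_ofDrive src code)
  set G : Drive → ℝ≥0∞ := Set.indicator {q | q.2.2.2 = 0} fun q => f (ofDrive src code q) with hG
  have hGm : Measurable G := hF.indicator (measurableSet_eq_fun (by fun_prop) measurable_const)
  set c : ℝ≥0∞ := (uniformOn (Set.Iio code.len) : Measure ℕ) {0} with hc
  have hc0 : c ≠ 0 := by
    rw [hc, Ne, uniformOn_eq_zero_iff (Set.finite_Iio _)]
    exact (Set.nonempty_iff_ne_empty.1 ⟨0, code.len_pos, rfl⟩)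
  have hle : ∫⁻ q, G q ∂(driveLaw src code) ≤
      ∫⁻ ω, ruleError src code η g t ω ∂(sourceLaw src code) := by
    rw [← (measurePreserving_drive src code 0).lintegral_comp hGm]
    refine lintegral_mono fun ω => ?_
    by_cases h0 : offset ω = 0
    · have hGe : G (drive src code 0 ω) = f (ofDrive src code (drive src code 0 ω)) :=
        Set.indicator_of_mem (by exact h0) _
      rw [hGe, ruleError, if_neg (by omega), superblock_superblockOf, h0, Nat.sub_zero, hplace, hlen,
        Nat.zero_mul]
    · have hGe : G (drive src code 0 ω) = 0 := Set.indicator_of_notMem (by exact h0) _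
      rw [hGe]
      exact zero_le
  have hprod : (∫⁻ q, f (ofDrive src code q) ∂(driveLaw src code)) * c ≤
      ∫⁻ q, G q ∂(driveLaw src code) := by
    have hsplit : ∀ E : Drive → ℝ≥0∞, Measurable E → ∫⁻ q, E q ∂(driveLaw src code) =
        ∫⁻ w, ∫⁻ u, ∫⁻ u', ∫⁻ τ, E (w, u, u', τ) ∂(uniformOn (Set.Iio code.len) : Measure ℕ)
          ∂(Measure.infinitePi fun _ : ℕ => uniformLaw code.Δ)
          ∂(Measure.infinitePi fun _ : ℕ => uniformLaw code.Δ)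
          ∂(Measure.infinitePi fun _ : ℕ => src.noise) := fun E hE => by
      unfold driveLaw
      rw [lintegral_prod _ hE.aemeasurable]
      refine lintegral_congr fun w => ?_
      have hw : Measurable fun y => E (w, y) := hE.comp measurable_prodMk_left
      rw [lintegral_prod _ hw.aemeasurable]
      refine lintegral_congr fun u => ?_
      have hu : Measurable fun y => E (w, u, y) := hw.comp measurable_prodMk_left
      rw [lintegral_prod _ hu.aemeasurable]
    have hFc : Measurable fun q : Drive => f (ofDrive src code q) * c := hF.mul_const c
    rw [← lintegral_mul_const c hF, hsplit _ hFc, hsplit _ hGm]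
    refine lintegral_mono fun w => lintegral_mono fun u => lintegral_mono fun u' => ?_
    calc ∫⁻ τ, f (ofDrive src code (w, u, u', τ)) * c
          ∂(uniformOn (Set.Iio code.len) : Measure ℕ)
        = G (w, u, u', 0) * c := by
          -- `ofDrive` ignores the offset
          have h0 : ∀ τ, f (ofDrive src code (w, u, u', τ)) * c = G (w, u, u', 0) * c := fun τ => by
            congr 1
            exact (Set.indicator_of_mem (show (w, u, u', 0) ∈ {q : Drive | q.2.2.2 = 0} from rfl)
              fun q => f (ofDrive src code q)).symm
          simp only [h0, lintegral_const, measure_univ, mul_one]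
      _ = ∫⁻ τ in {0}, G (w, u, u', τ) ∂(uniformOn (Set.Iio code.len) : Measure ℕ) := by
          rw [lintegral_singleton]
      _ ≤ _ := setLIntegral_le_lintegral _ _
  have hfin := ne_top_of_le_ne_top (h t) (hprod.trans hle)
  rw [superblockLaw, lintegral_map hf (measurable_ofDrive src code)]
  intro htop
  rw [htop, ENNReal.top_mul hc0] at hfin
  exact hfin rfl

end Rules

/-! ### Bit errors of the masked stream -/

section Channel

variable {A C : Type u} {V : Type v} [MeasurableSpace A] [MeasurableSpace C] [MeasurableSpace V]
  {R : ℝ}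

theorem Channel.measurable_start :
    Measurable (Channel.start : (ℕ → A) → Π i : Finset.Iic 0, Channel.Coord A C i) :=
  measurable_pi_lambda (X := fun i : Finset.Iic 0 => Channel.Coord A C i) _ fun i => by
    obtain ⟨i, hi⟩ := i
    obtain rfl : i = 0 := Nat.le_zero.1 (Finset.mem_Iic.1 hi)
    exact measurable_id

theorem Channel.measurable_outputs :
    Measurable (Channel.outputs : (Π t, Channel.Coord A C t) → ℕ → C) :=
  measurable_pi_lambda _ fun t => measurable_pi_apply (X := Channel.Coord A C) (t + 1)

/-- The law of the channel outputs as a kernel from input sequences to output sequences. -/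
noncomputable def Channel.lawKernel (chan : Channel A C) : Kernel (ℕ → A) (ℕ → C) :=
  ((Kernel.traj chan.step 0).comap Channel.start Channel.measurable_start).map Channel.outputs

theorem Channel.lawKernel_apply (chan : Channel A C) (a : ℕ → A) :
    chan.lawKernel a = chan.law a := by
  rw [Channel.lawKernel, Kernel.map_apply _ Channel.measurable_outputs, Kernel.comap_apply,
    Channel.law]

instance Channel.isMarkovKernel_lawKernel (chan : Channel A C) : IsMarkovKernel chan.lawKernel :=
  Kernel.IsMarkovKernel.map _ Channel.measurable_outputs

theorem Channel.isProbabilityMeasure_law (chan : Channel A C) (a : ℕ → A) :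
    IsProbabilityMeasure (chan.law a) := by
  rw [← chan.lawKernel_apply]; infer_instance

variable (sys : CommSystem A C V R) (chan : Channel A C) (φ : ℕ)

theorem CommSystem.measurable_inputs :
    Measurable fun p : (ℕ → Bool) × V => sys.inputs φ p.1 p.2 :=
  measurable_pi_lambda _ fun t => (sys.enc_measurable φ t).comp
    (f := fun p : (ℕ → Bool) × V => (fun i : Fin ⌊R * (t + 1)⌋₊ => p.1 i, p.2)) (by fun_prop)

theorem CommSystem.measurable_received (i : ℕ) :
    Measurable fun p : (ℕ → C) × V => sys.received φ p.1 p.2 i :=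
  (sys.dec_measurable φ i).comp
    (f := fun p : (ℕ → C) × V =>
      ((fun s => p.1 s : Fin (⌈((i : ℝ) + 1) / R⌉₊ + φ) → C), p.2)) (by fun_prop)

/-- The probability, over the channel noise, of an error in message bit `i` of the stream `b`. -/
noncomputable def CommSystem.noiseError (b : ℕ → Bool) (x : V) (i : ℕ) : ℝ≥0∞ :=
  chan.law (sys.inputs φ b x) {c | sys.received φ c x i ≠ b i}

theorem CommSystem.measurableSet_error (b : ℕ → Bool) (x : V) (i : ℕ) :
    MeasurableSet {c : ℕ → C | sys.received φ c x i ≠ b i} :=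
  ((sys.measurable_received φ i).comp (f := fun c : ℕ → C => (c, x)) (by fun_prop))
    (measurableSet_singleton (b i)).compl

theorem CommSystem.measurable_noiseError (i : ℕ) :
    Measurable fun p : (ℕ → Bool) × V => sys.noiseError chan φ p.1 p.2 i := by
  let κ := chan.lawKernel.comap _ (sys.measurable_inputs φ)
  have hs : MeasurableSet {q : ((ℕ → Bool) × V) × (ℕ → C) |
      sys.received φ q.2 q.1.2 i ≠ q.1.1 i} := by
    refine (measurableSet_eq_fun ?_ (by fun_prop)).compl
    exact (sys.measurable_received φ i).comp
      (f := fun q : ((ℕ → Bool) × V) × (ℕ → C) => (q.2, q.1.2)) (by fun_prop)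
  convert! Kernel.measurable_kernel_prodMk_left (κ := κ) hs using 2 with p
  rw [Kernel.comap_apply, chan.lawKernel_apply]
  rfl

theorem CommSystem.measurable_bitError (i : ℕ) :
    Measurable fun b : ℕ → Bool => sys.bitError chan φ b i := by
  have := sys.common_prob
  exact (sys.measurable_noiseError chan φ i).lintegral_prod_right'

theorem measurable_xor_stream (b : ℕ → Bool) :
    Measurable fun (r : ℕ → Bool) p => xor (b p) (r p) :=
  measurable_pi_lambda _ fun p => (measurable_of_countable fun y => xor (b p) y).comp
    (measurable_pi_apply p)

/-- Fair bits remain fair bits when they are XORed with any stream. -/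
theorem map_xor_fairBits (b : ℕ → Bool) :
    fairBits.map (fun r p => xor (b p) (r p)) = fairBits := by
  have : IsProbabilityMeasure (uniformOn Set.univ : Measure Bool) :=
    isProbabilityMeasure_uniformOn Set.finite_univ Set.univ_nonempty
  rw [fairBits, Measure.infinitePi_map_pi (f := fun p y => xor (b p) y) _
    fun _ => measurable_of_countable _]
  congr 1
  funext p
  refine Measure.ext_of_singleton fun y => ?_
  rw [Measure.map_apply (measurable_of_countable _) (measurableSet_singleton _)]
  have hset : (fun z => xor (b p) z) ⁻¹' {y} = {xor (b p) y} := by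
    ext z
    cases b p <;> cases z <;> cases y <;> simp
  rw [hset, uniformOn_univ, uniformOn_univ, Measure.count_singleton, Measure.count_singleton]

theorem isProbabilityMeasure_fairBits : IsProbabilityMeasure fairBits := by
  have : IsProbabilityMeasure (uniformOn Set.univ : Measure Bool) :=
    isProbabilityMeasure_uniformOn Set.finite_univ Set.univ_nonempty
  unfold fairBits; infer_instance

/-- In either setting, *every* stream is conveyed reliably once it is masked: with a fair mask
because the masked stream is fair, and without a mask by uniform reliability. -/
theorem exists_maskedError_le {mask : Measure (ℕ → Bool)}
    (hsys : (sys.Reliable chan ∧ mask = fairBits) ∨ (sys.UniformlyReliable chan ∧ mask = zeroBits))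
    {ε : ℝ≥0∞} (hε : 0 < ε) :
    ∃ φ₀ : ℕ, ∀ φ ≥ φ₀, ∀ (b : ℕ → Bool) (i : ℕ),
      ∫⁻ r, sys.bitError chan φ (fun p => xor (b p) (r p)) i ∂mask ≤ ε := by
  rcases hsys with ⟨h, rfl⟩ | ⟨h, rfl⟩
  · obtain ⟨φ₀, hφ₀⟩ := h ε hε
    refine ⟨φ₀, fun φ hφ b i => ?_⟩
    rw [← lintegral_map (sys.measurable_bitError chan φ i) (measurable_xor_stream b),
      map_xor_fairBits]
    exact hφ₀ φ hφ i
  · obtain ⟨φ₀, hφ₀⟩ := h ε hε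
    refine ⟨φ₀, fun φ hφ b i => ?_⟩
    have : IsProbabilityMeasure zeroBits := by unfold zeroBits; infer_instance
    calc _ ≤ ∫⁻ _, ε ∂zeroBits := lintegral_mono fun r => hφ₀ φ hφ _ i
      _ = ε := by simp

end Channel

/-! ### Distortion of the code over the channel -/

section EndToEnd

variable {A C : Type u} {V : Type v} [MeasurableSpace A] [MeasurableSpace C] [MeasurableSpace V]
  {R : ℝ} {src : Source} {code : Code} (chan : Channel A C) (sys : CommSystem A C V R) (φ : ℕ)

theorem historyStream_position (ω : Outcome) (m : ℕ) (j : Fin code.K) :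
    historyStream src code ω (position code m j) = historyBits src code ω m j := by
  have hdiv : position code m j / code.K = m + 2 := by
    rw [position, add_comm, Nat.add_mul_div_right _ _ code.K_pos, Nat.div_eq_of_lt j.2, zero_add]
  have hmod : position code m j % code.K = j := by
    rw [position, add_comm, Nat.add_mul_mod_self_right, Nat.mod_eq_of_lt j.2]
  have hlt : ¬ position code m j < 2 * code.K := by
    rw [position, Nat.add_mul]; omega
  simp only [historyStream, if_neg hlt, hdiv, hmod, Nat.add_sub_cancel, Fin.eta]

/-- Integrating out the channel, the common randomness and the mask for a fixed source outcome.
The integrand `D` equals `d` unless one of the bits in `I` is wrong, and then both are at most `S`.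
`D` need not be measurable, as it is only ever added to measurable functions. -/
theorem lintegral_channel_close {mask : Measure (ℕ → Bool)} [IsProbabilityMeasure mask]
    (b : ℕ → Bool) (I : Finset ℕ) (d S : ℝ≥0∞) (D : (ℕ → Bool) → V → (ℕ → C) → ℝ≥0∞)
    (h₁ : ∀ r x c, (∀ i ∈ I, sys.received φ c x i = xor (b i) (r i)) → D r x c = d)
    (hd : d ≤ S) (hD : ∀ r x c, D r x c ≤ S) :
    Close (∫⁻ r, ∫⁻ x, ∫⁻ c, D r x c ∂(chan.law (sys.inputs φ (fun p => xor (b p) (r p)) x))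
        ∂sys.common ∂mask) d
      ((∑ i ∈ I, ∫⁻ r, sys.bitError chan φ (fun p => xor (b p) (r p)) i ∂mask) * S) := by
  have := sys.common_prob
  have hlaw := fun a => chan.isProbabilityMeasure_law a
  let b' : (ℕ → Bool) → ℕ → Bool := fun r p => xor (b p) (r p)
  -- the number of bit errors in `I`
  let N : (ℕ → Bool) → V → (ℕ → C) → ℝ≥0∞ := fun r x c =>
    ∑ i ∈ I, Set.indicator {c | sys.received φ c x i ≠ b' r i} 1 c
  have hN : ∀ r x c, (∀ i ∈ I, sys.received φ c x i = b' r i) ∨ 1 ≤ N r x c := by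
    intro r x c
    by_cases h : ∀ i ∈ I, sys.received φ c x i = b' r i
    · exact Or.inl h
    · push Not at h
      obtain ⟨i, hi, hne⟩ := h
      refine Or.inr ?_
      have h1 : Set.indicator {c | sys.received φ c x i ≠ b' r i} (1 : (ℕ → C) → ℝ≥0∞) c = 1 :=
        Set.indicator_of_mem (s := {c | sys.received φ c x i ≠ b' r i}) hne 1
      rw [← h1]
      exact Finset.single_le_sum
        (f := fun i => Set.indicator {c | sys.received φ c x i ≠ b' r i} (1 : (ℕ → C) → ℝ≥0∞) c)
        (fun _ _ => zero_le) hi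
  have hNm : ∀ r x, Measurable (N r x) := fun r x =>
    Finset.measurable_fun_sum _ fun i _ =>
      measurable_one.indicator (sys.measurableSet_error φ (b' r) x i)
  have hNc : ∀ r x, ∫⁻ c, N r x c * S ∂(chan.law (sys.inputs φ (b' r) x)) =
      (∑ i ∈ I, sys.noiseError chan φ (b' r) x i) * S := by
    intro r x
    rw [lintegral_mul_const _ (hNm r x), lintegral_finsetSum _ fun i _ =>
      measurable_one.indicator (sys.measurableSet_error φ (b' r) x i)]
    congr 1
    refine Finset.sum_congr rfl fun i _ => ?_
    rw [lintegral_indicator_one (sys.measurableSet_error φ (b' r) x i)]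
    rfl
  have hb' : Measurable b' := measurable_xor_stream b
  have hxm : ∀ i r, Measurable fun x => sys.noiseError chan φ (b' r) x i := fun i r =>
    (sys.measurable_noiseError chan φ i).comp (f := fun x => (b' r, x)) (by fun_prop)
  have hxS : ∀ r, Measurable fun x => (∑ i ∈ I, sys.noiseError chan φ (b' r) x i) * S := fun r =>
    (Finset.measurable_fun_sum _ fun i _ => hxm i r).mul_const S
  have hNx : ∀ r, ∫⁻ x, (∑ i ∈ I, sys.noiseError chan φ (b' r) x i) * S ∂sys.common =
      (∑ i ∈ I, sys.bitError chan φ (b' r) i) * S := by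
    intro r
    rw [lintegral_mul_const _ (Finset.measurable_fun_sum _ fun i _ => hxm i r),
      lintegral_finsetSum _ fun i _ => hxm i r]
    rfl
  have hrm : ∀ i, Measurable fun r => sys.bitError chan φ (b' r) i := fun i =>
    (sys.measurable_bitError chan φ i).comp hb'
  have hrS : Measurable fun r => (∑ i ∈ I, sys.bitError chan φ (b' r) i) * S :=
    (Finset.measurable_fun_sum _ fun i _ => hrm i).mul_const S
  have hNr : ∫⁻ r, (∑ i ∈ I, sys.bitError chan φ (b' r) i) * S ∂mask =
      (∑ i ∈ I, ∫⁻ r, sys.bitError chan φ (b' r) i ∂mask) * S := by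
    rw [lintegral_mul_const _ (Finset.measurable_fun_sum _ fun i _ => hrm i),
      lintegral_finsetSum _ fun i _ => hrm i]
  have hsum : ∀ F : (ℕ → Bool) → V → (ℕ → C) → ℝ≥0∞,
      ∫⁻ r, ∫⁻ x, ∫⁻ c, (F r x c + N r x c * S) ∂(chan.law (sys.inputs φ (b' r) x))
        ∂sys.common ∂mask =
      ∫⁻ r, ∫⁻ x, ∫⁻ c, F r x c ∂(chan.law (sys.inputs φ (b' r) x)) ∂sys.common ∂mask +
        (∑ i ∈ I, ∫⁻ r, sys.bitError chan φ (b' r) i ∂mask) * S := by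
    intro F
    rw [← hNr, ← lintegral_add_right _ hrS]
    refine lintegral_congr fun r => ?_
    rw [← hNx, ← lintegral_add_right _ (hxS r)]
    refine lintegral_congr fun x => ?_
    rw [← hNc, ← lintegral_add_right _ ((hNm r x).mul_const S)]
  have hconst : ∫⁻ r, ∫⁻ x, ∫⁻ _, d ∂(chan.law (sys.inputs φ (b' r) x)) ∂sys.common ∂mask = d := by
    simp
  have hle : ∀ {e : ℝ≥0∞} (r x c), e ≤ S → 1 ≤ N r x c → e ≤ N r x c * S := fun r x c he h =>
    he.trans (by simpa using mul_le_mul_left h S)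
  constructor
  · rw [← hconst, ← hsum]
    refine lintegral_mono fun r => lintegral_mono fun x => lintegral_mono fun c => ?_
    rcases hN r x c with h | h
    · exact (h₁ r x c h).le.trans le_self_add
    · exact (hle r x c (hD r x c) h).trans le_add_self
  · rw [← hsum]
    refine hconst.symm.le.trans ?_
    refine lintegral_mono fun r => lintegral_mono fun x => lintegral_mono fun c => ?_
    rcases hN r x c with h | h
    · exact (h₁ r x c h).ge.trans le_self_add
    · exact (hle r x c hd h).trans le_add_self

/-- For a fixed source outcome each historical bit is wrong with probability at most `ε`, so the
channel changes the expected distortion by at most `Kε` times the sum of the distortions of all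
possible bit strings. -/
theorem endToEndDistortion_close {η : ℝ} {mask : Measure (ℕ → Bool)} [IsProbabilityMeasure mask]
    {ε : ℝ≥0∞} (hε : ∀ (b : ℕ → Bool) (i : ℕ),
      ∫⁻ r, sys.bitError chan φ (fun p => xor (b p) (r p)) i ∂mask ≤ ε) (t : ℕ) :
    Close (endToEndDistortion src code chan sys φ η mask t) (noiselessDistortion src code η t)
      (code.K * ε * ∑ b, fixedBitsDistortion src code η b t) := by
  have hbm : ∀ b : Fin code.K → Bool, Measurable fun ω =>
      distortion η (process src.lam ω t) (estimate src code ω b t) := fun b => by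
    convert! measurable_ruleError (src := src) η
      (measurable_rule (code := code) (β := fun _ => b) measurable_const) t using 1
    funext ω
    exact distortion_estimate η (fun _ => b) t ω
  have hnm : Measurable fun ω => distortion η (process src.lam ω t)
      (estimate src code ω (historyBits src code ω (superblockOf code ω t)) t) := by
    convert! measurable_ruleError (src := src) η (measurable_rule code.enc_measurable) t using 1
    funext ω
    exact distortion_estimate η (Function.uncurry code.enc) t ω
  let S : Outcome → ℝ≥0∞ := fun ω =>
    ∑ b, distortion η (process src.lam ω t) (estimate src code ω b t)
  have hSm : Measurable fun ω => code.K * ε * S ω :=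
    (Finset.measurable_fun_sum _ fun b _ => hbm b).const_mul _
  have hSi : ∫⁻ ω, code.K * ε * S ω ∂(sourceLaw src code) =
      code.K * ε * ∑ b, fixedBitsDistortion src code η b t := by
    rw [lintegral_const_mul _ (Finset.measurable_fun_sum _ fun b _ => hbm b),
      lintegral_finsetSum _ fun b _ => hbm b]
    rfl
  have hS : ∀ ω b, distortion η (process src.lam ω t) (estimate src code ω b t) ≤ S ω := fun ω b =>
    Finset.single_le_sum
      (f := fun b => distortion η (process src.lam ω t) (estimate src code ω b t))
      (fun _ _ => zero_le) (Finset.mem_univ b)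
  have hω : ∀ ω, Close (∫⁻ r, ∫⁻ x, ∫⁻ c, distortion η (process src.lam ω t)
        (endToEndEstimate src code sys φ ω r x c t)
        ∂(chan.law (channelInputs src code sys φ ω r x)) ∂sys.common ∂mask)
      (distortion η (process src.lam ω t)
        (estimate src code ω (historyBits src code ω (superblockOf code ω t)) t))
      (code.K * ε * S ω) := by
    intro ω
    have h := lintegral_channel_close chan sys φ (mask := mask) (historyStream src code ω)
      (Finset.univ.image (position code (superblockOf code ω t))) _ (S ω)
      (fun r x c => distortion η (process src.lam ω t)
        (endToEndEstimate src code sys φ ω r x c t)) (fun r x c hc => ?_)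
      (hS ω (historyBits src code ω (superblockOf code ω t))) (fun r x c => hS ω _)
    · have hsum : (∑ i ∈ Finset.univ.image (position code (superblockOf code ω t)),
          ∫⁻ r, sys.bitError chan φ (fun p => xor (historyStream src code ω p) (r p)) i ∂mask) ≤
          code.K * ε := by
        refine (Finset.sum_le_card_nsmul _ _ ε fun i _ => hε _ i).trans ?_
        rw [nsmul_eq_mul]
        gcongr
        simpa using Finset.card_image_le (s := Finset.univ)
          (f := position code (superblockOf code ω t))
      exact ⟨h.1.trans (add_le_add le_rfl (mul_le_mul' hsum le_rfl)),
        h.2.trans (add_le_add le_rfl (mul_le_mul' hsum le_rfl))⟩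
    · have hrec : receivedBits code sys φ r x c (superblockOf code ω t) =
          historyBits src code ω (superblockOf code ω t) := by
        funext j
        rw [receivedBits, hc _ (Finset.mem_image_of_mem _ (Finset.mem_univ j)),
          historyStream_position, Bool.xor_assoc, Bool.xor_self, Bool.xor_false]
      simp only [endToEndEstimate, hrec]
  constructor
  · rw [← hSi, noiselessDistortion, ← lintegral_add_left hnm]
    exact lintegral_mono fun ω => (hω ω).1
  · rw [← hSi, endToEndDistortion, ← lintegral_add_right _ hSm]
    exact lintegral_mono fun ω => (hω ω).2

theorem isProbabilityMeasure_mask {mask : Measure (ℕ → Bool)}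
    (hsys : (sys.Reliable chan ∧ mask = fairBits) ∨
      (sys.UniformlyReliable chan ∧ mask = zeroBits)) : IsProbabilityMeasure mask := by
  rcases hsys with ⟨-, rfl⟩ | ⟨-, rfl⟩
  · exact isProbabilityMeasure_fairBits
  · unfold zeroBits; infer_instance

/-- If the distortion with any fixed bits is finite at all times, it is bounded in time, and so a
small bit-error probability changes the distortion little, uniformly in time. -/
theorem exists_delay_close {η : ℝ} (hη : 0 ≤ η) {mask : Measure (ℕ → Bool)}
    (hsys : (sys.Reliable chan ∧ mask = fairBits) ∨ (sys.UniformlyReliable chan ∧ mask = zeroBits))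
    (hfin : ∀ b t, fixedBitsDistortion src code η b t ≠ ∞) {δ : ℝ≥0∞} (hδ : 0 < δ) :
    ∃ φ₀ : ℕ, ∀ φ ≥ φ₀, ∀ t, Close (endToEndDistortion src code chan sys φ η mask t)
      (noiselessDistortion src code η t) δ := by
  have := isProbabilityMeasure_mask chan sys hsys
  have hfix : ∀ b t, fixedBitsDistortion src code η b t =
      ∫⁻ ω, ruleError src code η (code.rule fun _ => b) t ω ∂(sourceLaw src code) := fun b t =>
    lintegral_congr fun ω => distortion_estimate η (fun _ => b) t ω
  have hrule : ∀ b, Measurable (code.rule fun _ => b) := fun b => measurable_rule measurable_const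
  let c : (Fin code.K → Bool) → ℝ≥0∞ := fun b => ENNReal.ofReal ((code.Δ / 2) ^ η) +
    code.len * ∑ p, ∫⁻ y, placeError η (code.rule fun _ => b) p y ∂(superblockLaw src code)
  have hc : code.K * ∑ b, c b ≠ ∞ := by
    refine ENNReal.mul_ne_top (ENNReal.natCast_ne_top _) (ENNReal.sum_ne_top.2 fun b _ => ?_)
    refine ENNReal.add_ne_top.2 ⟨ENNReal.ofReal_ne_top, ENNReal.mul_ne_top
      (ENNReal.natCast_ne_top _) (ENNReal.sum_ne_top.2 fun p _ => ?_)⟩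
    exact lintegral_placeError_ne_top (hrule b) (fun t => hfix b t ▸ hfin b t) p
  obtain ⟨ε, hε, hεδ⟩ := ENNReal.exists_nnreal_pos_mul_lt hc hδ.ne'
  obtain ⟨φ₀, hφ₀⟩ := exists_maskedError_le sys chan hsys (ε := ε) (by exact_mod_cast hε)
  refine ⟨φ₀, fun φ hφ t => ?_⟩
  have h := endToEndDistortion_close (src := src) (code := code) (η := η) chan sys φ
    (hφ₀ φ hφ) t
  have hle : code.K * ε * ∑ b, fixedBitsDistortion src code η b t ≤ δ := by
    calc code.K * ε * ∑ b, fixedBitsDistortion src code η b t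
        ≤ code.K * ε * ∑ b, c b := by
          gcongr with b
          rw [hfix]
          exact lintegral_ruleError_le hη (hrule b) t
      _ = ε * (code.K * ∑ b, c b) := by ring
      _ ≤ δ := hεδ.le
  exact ⟨h.1.trans (add_le_add le_rfl hle), h.2.trans (add_le_add le_rfl hle)⟩

end EndToEnd

/-! ### Truncated decoders -/

section Truncation

theorem abs_sub_clip_le {h x L : ℝ} (hL : |h| ≤ L) : |h - max (-L) (min L x)| ≤ |h - x| := by
  obtain ⟨h1, h2⟩ := abs_le.1 hL
  rcases le_total L x with hx | hx
  · rw [min_eq_left hx, max_eq_right (by linarith), abs_of_nonpos (by linarith),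
      abs_of_nonpos (by linarith)]
    linarith
  · rw [min_eq_right hx]
    rcases le_total (-L) x with hx' | hx'
    · rw [max_eq_right hx']
    · rw [max_eq_left hx', abs_of_nonneg (by linarith), abs_of_nonneg (by linarith)]
      linarith

theorem clip_eq_self {x L : ℝ} (hL : |x| ≤ L) : max (-L) (min L x) = x := by
  obtain ⟨h1, h2⟩ := abs_le.1 hL
  rw [min_eq_right h2, max_eq_right h1]

theorem abs_clip_le {L : ℝ} (hL : 0 ≤ L) (x : ℝ) : |max (-L) (min L x)| ≤ L :=
  abs_le.2 ⟨le_max_left _ _, max_le (by linarith) (min_le_left _ _)⟩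

/-- The rule `g` with its values limited to `[-L, L]`. -/
noncomputable def clipRule {code : Code} (L : ℝ) (g : Rule code) : Rule code :=
  fun y k i => max (-L) (min L (g y k i))

variable {src : Source} {code : Code}

theorem measurable_clipRule (L : ℝ) {g : Rule code} (hg : Measurable g) :
    Measurable (clipRule L g) :=
  measurable_pi_lambda _ fun k => measurable_pi_lambda _ fun i =>
    measurable_const.max (measurable_const.min
      ((measurable_pi_apply i).comp ((measurable_pi_apply k).comp hg)))

theorem noiselessDistortion_eq (η : ℝ) (t : ℕ) :
    noiselessDistortion src code η t =
      ∫⁻ ω, ruleError src code η (code.rule (Function.uncurry code.enc)) t ω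
        ∂(sourceLaw src code) :=
  lintegral_congr fun ω => distortion_estimate η (Function.uncurry code.enc) t ω

theorem noiselessDistortion_truncate (η L : ℝ) (t : ℕ) :
    noiselessDistortion src (code.truncate L) η t =
      ∫⁻ ω, ruleError src code η (clipRule L (code.rule (Function.uncurry code.enc))) t ω
        ∂(sourceLaw src code) :=
  noiselessDistortion_eq (code := code.truncate L) η t

theorem fixedBitsDistortion_truncate (η L : ℝ) (b : Fin code.K → Bool) (t : ℕ) :
    fixedBitsDistortion src (code.truncate L) η b t =
      ∫⁻ ω, ruleError src code η (clipRule L (code.rule fun _ => b)) t ω ∂(sourceLaw src code) :=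
  lintegral_congr fun ω =>
    distortion_estimate (src := src) (code := code.truncate L) η (fun _ => b) t ω

theorem ae_uniformLaw_abs_le (a : ℝ) : ∀ᵐ x ∂(uniformLaw a), |x| ≤ a / 2 :=
  (ae_cond_mem measurableSet_Icc).mono fun x hx => abs_le.2 ⟨by linarith [hx.1], hx.2⟩

/-- The normalized histories are bounded: unlike the source itself they start from a bounded
checkpoint error. -/
theorem exists_abs_history_le (src : Source) (code : Code) :
    ∃ B : ℝ, ∀ᵐ y ∂(superblockLaw src code), ∀ k i, |y.1 k i| ≤ B := by
  have := isProbabilityMeasure_uniformLaw code.Δ_pos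
  have := src.noise_prob
  have := isProbabilityMeasure_offsetLaw code
  obtain ⟨B₀, hB₀⟩ := src.noise_bounded
  have hw : ∀ᵐ p ∂(driveLaw src code), ∀ j, |p.1 j| ≤ B₀ := ae_all_iff.2 fun j =>
    (((measurePreserving_eval_infinitePi (fun _ : ℕ => src.noise) j).comp
      (measurePreserving_fst (ν := (Measure.infinitePi fun _ : ℕ => uniformLaw code.Δ).prod
        ((Measure.infinitePi fun _ : ℕ => uniformLaw code.Δ).prod
          (uniformOn (Set.Iio code.len)))))).quasiMeasurePreserving).ae hB₀
  have hu : ∀ᵐ p ∂(driveLaw src code), ∀ j, |p.2.1 j| ≤ code.Δ / 2 := ae_all_iff.2 fun j =>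
    (((measurePreserving_eval_infinitePi (fun _ : ℕ => uniformLaw code.Δ) j).comp
      (measurePreserving_fst (ν := (Measure.infinitePi fun _ : ℕ => uniformLaw code.Δ).prod
          (uniformOn (Set.Iio code.len))))).comp
      (measurePreserving_snd
        (μ := Measure.infinitePi fun _ : ℕ => src.noise))).quasiMeasurePreserving.ae
      (ae_uniformLaw_abs_le code.Δ)
  choose b hb using exists_abs_driven_le src.lam (code.Δ / 2) B₀
  refine ⟨∑ i ∈ Finset.range code.n, |b i|, ?_⟩
  refine (ae_map_iff (measurable_ofDrive src code).aemeasurable ?_).2 ?_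
  · have : {y : Superblock code | ∀ k i, |y.1 k i| ≤ ∑ i ∈ Finset.range code.n, |b i|} =
        ⋂ k, ⋂ i, {y | |y.1 k i| ≤ ∑ i ∈ Finset.range code.n, |b i|} := by
      ext; simp
    rw [this]
    refine .iInter fun k => .iInter fun i => measurableSet_le ?_ measurable_const
    simp only [← Real.norm_eq_abs]; fun_prop
  · filter_upwards [hw, hu] with p hpw hpu k i
    refine (hb i _ _ (hpu _) fun j => hpw _).trans ((le_abs_self _).trans ?_)
    exact Finset.single_le_sum (f := fun i => |b i|) (fun _ _ => abs_nonneg _)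
      (Finset.mem_range.2 i.2)

theorem isProbabilityMeasure_superblockLaw (src : Source) (code : Code) :
    IsProbabilityMeasure (superblockLaw src code) := by
  have := isProbabilityMeasure_driveLaw src code
  exact Measure.isProbabilityMeasure_map (measurable_ofDrive src code).aemeasurable

theorem fixedBitsDistortion_truncate_ne_top {η : ℝ} (hη : 0 ≤ η) {L : ℝ} (hL : 0 ≤ L)
    (b : Fin code.K → Bool) (t : ℕ) :
    fixedBitsDistortion src (code.truncate L) η b t ≠ ∞ := by
  have := isProbabilityMeasure_superblockLaw src code
  obtain ⟨B, hB⟩ := exists_abs_history_le src code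
  rw [fixedBitsDistortion_truncate]
  refine ne_top_of_le_ne_top ?_ (lintegral_ruleError_le hη
    (measurable_clipRule L (measurable_rule measurable_const)) t)
  refine ENNReal.add_ne_top.2 ⟨ENNReal.ofReal_ne_top, ENNReal.mul_ne_top
    (ENNReal.natCast_ne_top _) (ENNReal.sum_ne_top.2 fun p _ => ?_)⟩
  refine ne_top_of_le_ne_top (b := ENNReal.ofReal ((B + L) ^ η)) ENNReal.ofReal_ne_top ?_
  calc ∫⁻ y, placeError η (clipRule L (code.rule fun _ => b)) p y ∂(superblockLaw src code)
      ≤ ∫⁻ _, ENNReal.ofReal ((B + L) ^ η) ∂(superblockLaw src code) := by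
        refine lintegral_mono_ae (hB.mono fun y hy => ?_)
        refine ENNReal.ofReal_le_ofReal (Real.rpow_le_rpow (abs_nonneg _) ?_ hη)
        exact (abs_sub _ _).trans (add_le_add (hy _ _) (abs_clip_le hL _))
    _ = _ := by simp

/-- The distortion of a truncated rule converges to that of the rule as the level grows, uniformly
in time. -/
theorem exists_level_close {η : ℝ} (hη : 0 ≤ η) {g : Rule code} (hg : Measurable g)
    (h : ∀ t, ∫⁻ ω, ruleError src code η g t ω ∂(sourceLaw src code) ≠ ∞)
    {δ : ℝ≥0∞} (hδ : 0 < δ) :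
    ∃ L₀ : ℝ, 0 ≤ L₀ ∧ ∀ L ≥ L₀, ∀ t,
      Close (∫⁻ ω, ruleError src code η (clipRule L g) t ω ∂(sourceLaw src code))
        (∫⁻ ω, ruleError src code η g t ω ∂(sourceLaw src code)) δ := by
  obtain ⟨B, hB⟩ := exists_abs_history_le src code
  have hlim : ∀ p, Filter.Tendsto (fun L => ∫⁻ y, (placeError η g p y -
      placeError η (clipRule L g) p y) ∂(superblockLaw src code)) Filter.atTop (nhds 0) := by
    intro p
    rw [← lintegral_zero (μ := superblockLaw src code)]
    refine tendsto_lintegral_filter_of_dominated_convergence (placeError η g p)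
      (.of_forall fun L => (measurable_placeError η hg p).sub
        (measurable_placeError η (measurable_clipRule L hg) p))
      (.of_forall fun L => .of_forall fun y => tsub_le_self)
      (lintegral_placeError_ne_top hg h p) (.of_forall fun y => ?_)
    refine tendsto_const_nhds.congr' ?_
    filter_upwards [Filter.eventually_ge_atTop |g y p.1 p.2|] with L hL
    simp only [placeError, clipRule, clip_eq_self hL, tsub_self]
  have hsum : Filter.Tendsto (fun L => (code.len : ℝ≥0∞) * ∑ p, ∫⁻ y, (placeError η g p y -
      placeError η (clipRule L g) p y) ∂(superblockLaw src code)) Filter.atTop (nhds 0) := by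
    have h0 := ENNReal.Tendsto.const_mul (a := (code.len : ℝ≥0∞))
      (tendsto_finsetSum Finset.univ fun p _ => hlim p) (Or.inr (ENNReal.natCast_ne_top _))
    simpa using h0
  obtain ⟨L₁, hL₁⟩ := Filter.eventually_atTop.1 (hsum.eventually_le_const hδ)
  refine ⟨max L₁ (max B 0), by simp, fun L hL t => ?_⟩
  have hLB : B ≤ L := ((le_max_left _ _).trans (le_max_right _ _)).trans hL
  constructor
  · have hzero : ∀ p, ∫⁻ y, (placeError η (clipRule L g) p y - placeError η g p y)
        ∂(superblockLaw src code) = 0 := fun p => by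
      refine (lintegral_congr_ae (hB.mono fun y hy => ?_)).trans lintegral_zero
      exact tsub_eq_zero_of_le (distortion_le_of_abs_sub_le hη
        (abs_sub_clip_le ((hy p.1 p.2).trans hLB)))
    refine (lintegral_ruleError_le_add (measurable_clipRule L hg) hg t).trans ?_
    simp [hzero]
  · exact (lintegral_ruleError_le_add hg (measurable_clipRule L hg) t).trans
      (add_le_add le_rfl (hL₁ L ((le_max_left _ _).trans hL)))

end Truncation

/-! ### Causality and delay -/

section Causality

variable {A C : Type u} {V : Type v} [MeasurableSpace A] [MeasurableSpace C] [MeasurableSpace V]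
  {R : ℝ} (src : Source) (code : Code) (sys : CommSystem A C V R) (φ : ℕ)

/-- The bits of superblock `m` depend on the source up to the end of that superblock. -/
theorem historyBits_congr {ω ω' : Outcome} (hω : ω.2.2 = ω'.2.2) (m : ℕ)
    (h : ∀ t < offset ω + (m + 1) * code.len, process src.lam ω t = process src.lam ω' t) :
    historyBits src code ω m = historyBits src code ω' m := by
  have hstart : ∀ k, blockStart code ω' k = blockStart code ω k := fun k => by
    simp only [blockStart, offset, hω]
  have hd : ∀ t, dither ω' t = dither ω t := fun t => by simp only [dither, hω]
  have hd' : ∀ t, ditherEnd ω' t = ditherEnd ω t := fun t => by simp only [ditherEnd, hω]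
  have hp : ∀ (k : Fin code.M) (i : ℕ), i < code.n →
      process src.lam ω (blockStart code ω (m * code.M + k) + i) =
        process src.lam ω' (blockStart code ω (m * code.M + k) + i) := by
    intro k i hi
    refine h _ ?_
    have h1 : (m * code.M + k + 1) * code.n ≤ (m + 1) * code.len := by
      rw [Code.len, mul_comm code.n, ← mul_assoc, add_mul m 1, one_mul]
      exact Nat.mul_le_mul_right _ (by have := k.2; omega)
    rw [add_mul, one_mul] at h1
    simp only [blockStart]
    omega
  have hp0 := fun k : Fin code.M => hp k 0 code.n_pos
  simp only [add_zero] at hp0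
  unfold historyBits
  congr 1
  · funext k i
    simp only [history, checkpoint, hstart, hd, hp k i i.2, hp0 k]
  · funext k
    simp only [sideInfo, checkpoint, checkpointEnd, hstart, hd, hd', hp0 k,
      hp k (code.n - 1) (Nat.sub_lt code.n_pos one_pos)]

/-- With the two superblock lengths of filler, a superblock is over when the first of its bits is
due at the channel encoder, and all of its bits are due at most three superblock lengths after its
opening. -/
theorem causalWithDelay (hR : R = code.rate) :
    CausalWithDelay src code sys φ (φ + 3 * code.len) := by
  have hlen : (0 : ℝ) < code.len := by exact_mod_cast code.len_pos
  have hK : (0 : ℝ) < code.K := by exact_mod_cast code.K_pos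
  constructor
  · intro ω ω' r x s hT hω hX
    simp only [channelInputs, CommSystem.inputs]
    congr 1
    funext p
    congr 1
    unfold historyStream
    split_ifs with hp
    · rfl
    refine congrFun (historyBits_congr src code hω _ fun t ht => hX t ?_) _
    have hp2 : 2 ≤ p / code.K := (Nat.le_div_iff_mul_le code.K_pos).2 (not_lt.1 hp)
    have hdiv : (p : ℕ) / code.K * code.len ≤ s := by
      have h1 : ((p : ℕ) : ℝ) + 1 ≤ code.K / code.len * (s + 1) := by
        have hp' : (p : ℕ) + 1 ≤ ⌊R * (s + 1)⌋₊ := p.2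
        have hpos : 0 ≤ R * ((s : ℝ) + 1) := by
          rw [hR, Code.rate]; positivity
        have := ((Nat.le_floor_iff hpos).1 hp').trans_eq (congrArg (· * ((s : ℝ) + 1)) hR)
        exact_mod_cast this
      rw [div_mul_eq_mul_div, le_div_iff₀ hlen] at h1
      have h2 : ((p : ℕ) + 1) * code.len ≤ code.K * (s + 1) := by exact_mod_cast h1
      have h3 : (p : ℕ) / code.K * code.K ≤ p := Nat.div_mul_le_self _ _
      have h4 : code.K * ((p : ℕ) / code.K * code.len) < code.K * (s + 1) := by
        calc code.K * ((p : ℕ) / code.K * code.len)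
            = (p : ℕ) / code.K * code.K * code.len := by ring
          _ ≤ p * code.len := Nat.mul_le_mul_right _ h3
          _ < (p + 1) * code.len := Nat.mul_lt_mul_of_pos_right (Nat.lt_succ_self _) code.len_pos
          _ ≤ _ := h2
      exact Nat.lt_succ_iff.1 (Nat.lt_of_mul_lt_mul_left h4)
    obtain ⟨q, hq⟩ := Nat.exists_eq_add_of_le' hp2
    rw [hq] at hdiv ht
    simp only [Nat.add_sub_cancel, add_mul] at hdiv ht
    omega
  · intro ω r x c c' t hc
    unfold endToEndEstimate
    congr 1
    funext j
    unfold receivedBits CommSystem.received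
    congr 2
    funext i
    refine hc _ (i.2.trans_le ?_)
    have hm : superblockOf code ω t * code.len ≤ t :=
      (Nat.div_mul_le_self _ _).trans (Nat.sub_le _ _)
    have hceil : ⌈((position code (superblockOf code ω t) j : ℕ) + 1 : ℝ) / R⌉₊ ≤
        (superblockOf code ω t + 3) * code.len := by
      rw [Nat.ceil_le, hR, Code.rate, div_div_eq_mul_div, div_le_iff₀ hK]
      have h1 : position code (superblockOf code ω t) j + 1 ≤
          (superblockOf code ω t + 3) * code.K := by
        have := j.2
        simp only [position, add_mul]; omega
      have h2 : (position code (superblockOf code ω t) j + 1) * code.len ≤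
          (superblockOf code ω t + 3) * code.len * code.K := by
        calc _ ≤ (superblockOf code ω t + 3) * code.K * code.len := Nat.mul_le_mul_right _ h1
          _ = _ := by ring
      exact_mod_cast h2
    rw [add_mul] at hceil
    omega

end Causality

end TwoStream

theorem theorem3 {A C : Type u} {V : Type v} [MeasurableSpace A] [MeasurableSpace C]
    [MeasurableSpace V] (src : TwoStream.Source) (η : ℝ) (hη : 0 < η) (code : TwoStream.Code)
    (hcode : ∀ t, TwoStream.noiselessDistortion src code η t ≠ ∞)
    (chan : TwoStream.Channel A C) (sys : TwoStream.CommSystem A C V code.rate)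
    (mask : Measure (ℕ → Bool))
    (hsys : (sys.Reliable chan ∧ mask = TwoStream.fairBits) ∨
      (sys.UniformlyReliable chan ∧ mask = TwoStream.zeroBits)) :
    (∀ φ : ℕ, TwoStream.CausalWithDelay src code sys φ (φ + 3 * code.len) ∧
      ∀ L : ℝ, TwoStream.CausalWithDelay src (code.truncate L) sys φ (φ + 3 * code.len)) ∧
    ((∀ b t, TwoStream.fixedBitsDistortion src code η b t ≠ ∞) →
      ∀ δ : ℝ≥0∞, 0 < δ → ∃ φ₀ : ℕ, ∀ φ ≥ φ₀, ∀ t,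
        TwoStream.Close (TwoStream.endToEndDistortion src code chan sys φ η mask t)
          (TwoStream.noiselessDistortion src code η t) δ) ∧
    (∀ δ : ℝ≥0∞, 0 < δ → ∃ L₀ : ℝ, ∀ L ≥ L₀, ∃ φ₀ : ℕ, ∀ φ ≥ φ₀, ∀ t,
      TwoStream.Close (TwoStream.endToEndDistortion src (code.truncate L) chan sys φ η mask t)
        (TwoStream.noiselessDistortion src code η t) δ) := by
  refine ⟨fun φ => ⟨TwoStream.causalWithDelay src code sys φ rfl, fun L => ?_⟩,
    fun hfin δ hδ => TwoStream.exists_delay_close chan sys hη.le hsys hfin hδ, fun δ hδ => ?_⟩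
  · exact TwoStream.causalWithDelay src (code.truncate L) sys φ
      (by simp only [TwoStream.Code.rate, TwoStream.Code.len, TwoStream.Code.truncate])
  have hδ2 : 0 < δ / 2 := ENNReal.half_pos hδ.ne'
  obtain ⟨L₀, hL₀, hclose⟩ := TwoStream.exists_level_close (src := src) (code := code) hη.le
    (TwoStream.measurable_rule code.enc_measurable)
    (fun t => (TwoStream.noiselessDistortion_eq (src := src) (code := code) η t).symm.trans_ne
      (hcode t)) hδ2
  refine ⟨L₀, fun L hL => ?_⟩
  have hfin : ∀ (b : Fin (code.truncate L).K → Bool) t,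
      TwoStream.fixedBitsDistortion src (code.truncate L) η b t ≠ ∞ := fun b t =>
    TwoStream.fixedBitsDistortion_truncate_ne_top (code := code) hη.le (hL₀.trans hL) b t
  obtain ⟨φ₀, hφ₀⟩ := TwoStream.exists_delay_close (src := src) (code := code.truncate L) chan sys
    hη.le hsys hfin hδ2
  refine ⟨φ₀, fun φ hφ t => ?_⟩
  have h1 := hφ₀ φ hφ t
  have h2 := hclose L hL t
  rw [← TwoStream.noiselessDistortion_truncate, ← TwoStream.noiselessDistortion_eq] at h2
  rw [← ENNReal.add_halves δ]
  constructor
  · rw [add_comm (δ / 2), ← add_assoc]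
    exact h1.1.trans (add_le_add h2.1 le_rfl)
  · rw [← add_assoc]
    exact h2.2.trans (add_le_add h1.2 le_rfl)
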